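/- Let $n\ge 2$, let $N$ be a compact smooth $(n-1)$-dimensional manifold (with or without boundary), let $\hat G$ be a smooth Riemannian metric on $N$ with Riemannian measure $\mu_{\hat G}$, and let $M=(0,\infty)\times N$. Let $$g=dr^2+G(r)$$ be a smooth Riemannian metric on $M$, where $G(r)$, $r>0$, is a family of Riemannian metrics on $N$, and let $g_0=dr^2+\mathring G(r)$ with $\mathring G(r)=r^2\hat G$. Let $H$ and $\mathring H$ be the mean curvatures of the level sets $N(r)=\{r\}\times N$ relative to $g$ and $g_0$, i.e. the traces of the Weingarten maps $X\mapsto\nabla_X\partial_r$, and put $$m(r,x)=r^2(\mathring H-H)(r,x),\qquad \mathcal M(r)=\int_N m(r,x)\,d\mu_{\hat G}(x).$$ Let $R_{rr}=\mathrm{Ric}_g(\partial_r,\partial_r)$. Assume that the limits $\mathcal M(0)=\lim_{r\to0^+}\mathcal M(r)$ and $\mathcal M(+\infty)=\lim_{r\to+\infty}\mathcal M(r)$ exist in $\mathbb R$ and that $r^2R_{rr}\in L^1(dr\,d\mu_{\hat G})$ on $M$. Then $$\mathcal M(+\infty)-\mathcal M(0)\ \ge\ \int_M r^2R_{rr}\,dr\,d\mu_{\hat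 G},$$ with equality if and only if there is a smooth Riemannian metric $\widetilde G$ on $N$ such that $G(r)=r^2\widetilde G$ for all $r>0$. Moreover, if $g$ is asymptotic to $g_0$ at some $r_0\in[0,+\infty]$, meaning that $\|G(r)-\mathring G(r)\|_{\mathring G(r)}\to0$ uniformly on $N$ as $r\to r_0$ in $(0,\infty)$ (for $r_0\in(0,\infty)$ this says that $G(r_0)=\mathring G(r_0)$), then equality holds if and only if $g=g_0$. -/

import Mathlib

open Set Filter MeasureTheory Topology
open scoped Manifold ContDiff Bundle

noncomputable section

namespace RadialMass

/-! ### Christoffel symbols and Ricci curvature of a metric given in coordinates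

A coordinate domain is a set `s` of a normed space `V`, the coordinate vectors are `b i : V`
(`i : ι`), and a metric is its matrix-valued function `γ : V → Matrix ι ι ℝ` on `s`. Derivatives
are taken within `s`, so that boundary points of `s` are allowed. -/

section Coordinates

variable {ι V : Type*} [Fintype ι] [DecidableEq ι] [NormedAddCommGroup V] [NormedSpace ℝ V]

/-- The partial derivative `∂_i f` within `s`. -/
def pderiv (b : ι → V) (s : Set V) (i : ι) (f : V → ℝ) (p : V) : ℝ :=
  fderivWithin ℝ f s p (b i)

/-- `Γ^k_{ij} = ½ γ^{kl} (∂_i γ_{jl} + ∂_j γ_{il} - ∂_l γ_{ij})`. -/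
def christoffel (b : ι → V) (s : Set V) (γ : V → Matrix ι ι ℝ) (k i j : ι) (p : V) : ℝ :=
  (1 / 2) * ∑ l, (γ p)⁻¹ k l *
    (pderiv b s i (fun q => γ q j l) p + pderiv b s j (fun q => γ q i l) p
      - pderiv b s l (fun q => γ q i j) p)

/-- `Ric_{ij} = ∂_k Γ^k_{ij} - ∂_j Γ^k_{ik} + Γ^k_{kl} Γ^l_{ij} - Γ^k_{jl} Γ^l_{ik}`
(positive on round spheres). -/
def ricci (b : ι → V) (s : Set V) (γ : V → Matrix ι ι ℝ) (i j : ι) (p : V) : ℝ :=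
  ∑ k, (pderiv b s k (christoffel b s γ k i j) p - pderiv b s j (christoffel b s γ k i k) p)
    + ∑ k, ∑ l, (christoffel b s γ k k l p * christoffel b s γ l i j p
      - christoffel b s γ k j l p * christoffel b s γ l i k p)

end Coordinates

variable {d : ℕ} {H : Type*} [TopologicalSpace H]
  (I : ModelWithCorners ℝ (EuclideanSpace ℝ (Fin d)) H)
  {N : Type*} [TopologicalSpace N] [ChartedSpace H N]

/-! ### Coordinates on `N` -/

/-- The coordinate vector field `∂_A` of the chart of `N` at `x₀`, at the point of `N` whose
coordinates are `y`. -/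
def coordVector (x₀ : N) (y : EuclideanSpace ℝ (Fin d)) (A : Fin d) :
    TangentSpace I ((extChartAt I x₀).symm y) :=
  mfderivWithin 𝓘(ℝ, EuclideanSpace ℝ (Fin d)) I (extChartAt I x₀).symm (range I) y
    (EuclideanSpace.single A (1 : ℝ) : EuclideanSpace ℝ (Fin d))

/-- The matrix `B_{AC} = B(∂_A, ∂_C)` of a field of bilinear forms on `N`, in the chart at `x₀`, at
the point with coordinates `y`. -/
def coordMatrix (x₀ : N) (B : ∀ x : N, TangentSpace I x →L[ℝ] TangentSpace I x →L[ℝ] ℝ)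
    (y : EuclideanSpace ℝ (Fin d)) : Matrix (Fin d) (Fin d) ℝ :=
  Matrix.of fun A C =>
    B ((extChartAt I x₀).symm y) (coordVector I x₀ y A) (coordVector I x₀ y C)

/-- The norm `‖T‖_B = (B^{AC} B^{DE} T_{AD} T_{CE})^{1/2}` at `x` of a field `T` of symmetric
bilinear forms, with respect to a Riemannian metric `B` on `N`. -/
def tensorNorm (B T : ∀ x : N, TangentSpace I x →L[ℝ] TangentSpace I x →L[ℝ] ℝ) (x : N) : ℝ :=
  let β := (coordMatrix I x B (extChartAt I x x))⁻¹
  let τ := coordMatrix I x T (extChartAt I x x)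
  √(∑ A, ∑ C, ∑ D, ∑ E, β A C * β D E * τ A D * τ C E)

/-! ### The Riemannian volume measure of a metric on the compact manifold `N` -/

section Volume

/-- A partition of unity subordinate to the domains of the charts of `N`. -/
theorem exists_chartPartition [CompactSpace N] [T2Space N] :
    ∃ ρ : PartitionOfUnity N N univ, ρ.IsSubordinate fun x₀ => (extChartAt I x₀).source :=
  PartitionOfUnity.exists_isSubordinate isClosed_univ _
    (fun x₀ => isOpen_extChartAt_source x₀)
    (fun x _ => mem_iUnion.2 ⟨x, mem_extChartAt_source x⟩)

/-- A chosen partition of unity subordinate to the domains of the charts of `N`. -/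
def chartPartition [CompactSpace N] [T2Space N] : PartitionOfUnity N N univ :=
  (exists_chartPartition I).choose

/-- The Riemannian volume measure `μ_B` of a metric `B` on `N`: the sum over the charts of the
measures `ρ √(det B_{AC}) dy`, for a partition of unity `ρ` subordinate to the chart domains. (By
the change of variables formula it does not depend on the partition of unity.) -/
def volumeMeasure [CompactSpace N] [T2Space N] [MeasurableSpace N]
    (B : ∀ x : N, TangentSpace I x →L[ℝ] TangentSpace I x →L[ℝ] ℝ) : Measure N :=
  Measure.sum fun x₀ : N =>
    Measure.map (extChartAt I x₀).symm
      ((volume.restrict (extChartAt I x₀).target).withDensity fun y =>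
        ENNReal.ofReal (chartPartition I x₀ ((extChartAt I x₀).symm y)
          * √((coordMatrix I x₀ B y).det)))

end Volume

/-! ### Metrics `g = dr² + G(r)` on `M = (0, ∞) × N` -/

/-- `G(r)`, `r > 0`, is a family of Riemannian metrics on `N`, smooth in `(r, x) ∈ (0, ∞) × N`;
equivalently `g = dr² + G(r)` is a smooth Riemannian metric on `(0, ∞) × N`. The values of `G` for
`r ≤ 0` are irrelevant. -/
structure IsMetricFamily [IsManifold I ∞ N]
    (G : ℝ → ∀ x : N, TangentSpace I x →L[ℝ] TangentSpace I x →L[ℝ] ℝ) : Prop where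
  symm : ∀ r > 0, ∀ (x : N) (v w : TangentSpace I x), G r x v w = G r x w v
  pos : ∀ r > 0, ∀ (x : N) (v : TangentSpace I x), v ≠ 0 → 0 < G r x v v
  smooth : ContMDiffOn (𝓘(ℝ, ℝ).prod I)
    (I.prod 𝓘(ℝ, EuclideanSpace ℝ (Fin d) →L[ℝ] EuclideanSpace ℝ (Fin d) →L[ℝ] ℝ)) ∞
    (fun p : ℝ × N => (Bundle.TotalSpace.mk'
      (EuclideanSpace ℝ (Fin d) →L[ℝ] EuclideanSpace ℝ (Fin d) →L[ℝ] ℝ) p.2 (G p.1 p.2) :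
      Bundle.TotalSpace (EuclideanSpace ℝ (Fin d) →L[ℝ] EuclideanSpace ℝ (Fin d) →L[ℝ] ℝ)
        (fun x : N => TangentSpace I x →L[ℝ] TangentSpace I x →L[ℝ] ℝ)))
    (Ioi 0 ×ˢ univ)

/-- The coordinate vectors of the adapted coordinates `(r, x^A)`: `inl ()` stands for `∂_r` and
`inr A` for `∂_A`. -/
def radialBasis : Unit ⊕ Fin d → ℝ × EuclideanSpace ℝ (Fin d)
  | Sum.inl _ => (1, 0)
  | Sum.inr A => (0, EuclideanSpace.single A 1)

/-- The range of the adapted coordinates `(r, x^A)` given by the chart of `N` at `x₀`. -/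
def radialDomain (x₀ : N) : Set (ℝ × EuclideanSpace ℝ (Fin d)) :=
  Ioi 0 ×ˢ (extChartAt I x₀).target

/-- The matrix of `g = dr² + G(r)` in the adapted coordinates given by the chart of `N` at `x₀`. -/
def radialMatrix (x₀ : N) (G : ℝ → ∀ x : N, TangentSpace I x →L[ℝ] TangentSpace I x →L[ℝ] ℝ)
    (p : ℝ × EuclideanSpace ℝ (Fin d)) : Matrix (Unit ⊕ Fin d) (Unit ⊕ Fin d) ℝ :=
  Matrix.fromBlocks 1 0 0 (coordMatrix I x₀ (G p.1) p.2)

/-- `R_{rr}(r, x)`, the Ricci curvature of `g = dr² + G(r)` in the direction `(∂_r, ∂_r)`. -/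
def radialRicci (G : ℝ → ∀ x : N, TangentSpace I x →L[ℝ] TangentSpace I x →L[ℝ] ℝ)
    (r : ℝ) (x : N) : ℝ :=
  ricci radialBasis (radialDomain I x) (radialMatrix I x G) (Sum.inl ()) (Sum.inl ())
    (r, extChartAt I x x)

/-- The mean curvature at `(r, x)`, relative to `g = dr² + G(r)`, of the level set `N(r)` of `r`:
the trace of its Weingarten map `S = ∇ ∂_r`, whose components are `S_A^B = Γ^B_{A r}`. -/
def meanCurvature (G : ℝ → ∀ x : N, TangentSpace I x →L[ℝ] TangentSpace I x →L[ℝ] ℝ)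
    (r : ℝ) (x : N) : ℝ :=
  ∑ A : Fin d, christoffel radialBasis (radialDomain I x) (radialMatrix I x G)
    (Sum.inr A) (Sum.inr A) (Sum.inl ()) (r, extChartAt I x x)

/-- The family `h(r)² B` of the warped product metric `dr² + h(r)² B`. -/
def warped (h : ℝ → ℝ) (B : ∀ x : N, TangentSpace I x →L[ℝ] TangentSpace I x →L[ℝ] ℝ) (r : ℝ)
    (x : N) : TangentSpace I x →L[ℝ] TangentSpace I x →L[ℝ] ℝ :=
  (h r) ^ 2 • B x

/-- The radial mass `m(r, x) = h² (H₀ - H)` of `g = dr² + G(r)` relative to `g₀ = dr² + h(r)² B`,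
where `H` and `H₀` are the mean curvatures of `N(r)` relative to `g` and `g₀`. -/
def radialMass (h : ℝ → ℝ) (B : ∀ x : N, TangentSpace I x →L[ℝ] TangentSpace I x →L[ℝ] ℝ)
    (G : ℝ → ∀ x : N, TangentSpace I x →L[ℝ] TangentSpace I x →L[ℝ] ℝ) (r : ℝ) (x : N) : ℝ :=
  (h r) ^ 2 * (meanCurvature I (warped I h B) r x - meanCurvature I G r x)

/-- The radial mass `𝓜(r) = ∫_N m(r, x) dμ_B(x)` of `g` relative to `g₀` on `N(r)`. -/
def totalRadialMass [CompactSpace N] [T2Space N] [MeasurableSpace N] (h : ℝ → ℝ)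
    (B : ∀ x : N, TangentSpace I x →L[ℝ] TangentSpace I x →L[ℝ] ℝ)
    (G : ℝ → ∀ x : N, TangentSpace I x →L[ℝ] TangentSpace I x →L[ℝ] ℝ) (r : ℝ) : ℝ :=
  ∫ x, radialMass I h B G r x ∂(volumeMeasure I B)

/-- `r → r₀` with `r ∈ (0, ∞)`, for `r₀ ∈ [0, +∞]`. -/
def radialFilter (r₀ : EReal) : Filter ℝ :=
  comap ((↑) : ℝ → EReal) (𝓝 r₀) ⊓ 𝓟 (Ioi 0)

/-- `g = dr² + G(r)` is asymptotic to `g₀ = dr² + h(r)² B` at `r₀`: with `G₀ = h² B`,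
`‖G - G₀‖_{G₀} = o(1)` as `r → r₀`, uniformly on `N`. -/
def IsAsymptoticAt (h : ℝ → ℝ) (B : ∀ x : N, TangentSpace I x →L[ℝ] TangentSpace I x →L[ℝ] ℝ)
    (G : ℝ → ∀ x : N, TangentSpace I x →L[ℝ] TangentSpace I x →L[ℝ] ℝ) (r₀ : EReal) : Prop :=
  TendstoUniformly
    (fun (r : ℝ) (x : N) =>
      tensorNorm I (warped I h B r) (fun z => G r z - warped I h B r z) x)
    (fun _ => 0) (radialFilter r₀)

end RadialMass

end

/-! Let S be the Weingarten map of N(r) and d = n - 1. The cone g₀ has S = r⁻¹ id, so m = d r - r²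
tr S. The Riccati equation (tr S)' = -R_rr - tr S² (`ricci_radial`) and completion of the square
give ∂_r m = r² R_rr + r² tr (S - r⁻¹ id)² (`IsSmoothFamily.hasDerivAt_radialMass`). Since S is
self-adjoint for G, the last trace, the `defect`, is a squared norm: it is nonnegative, and zero
only if S = r⁻¹ id.

Integrate over (a, b] × N and exhaust (0, ∞): 𝓜(+∞) - 𝓜(0) - ∫ r² R_rr is the limit of the integrals
of r² `defect` over the pieces, which gives the inequality. Equality forces the defect to vanish
almost everywhere, hence everywhere, because it is continuous and the measure charges open sets.
Then ∂_r G = (2/r) G, so G(r) = r² G(1). For such a cone ‖G - G₀‖_{G₀} does not depend on r, so if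
it tends to 0 at some r₀ then G(1) = Ĝ.

At a given x everything is computed in the standard basis of the tangent space, which is the frame
at x of the preferred chart at x. That chart may jump with x, so continuity in x is proved in fixed
charts, where S is conjugated by a frame matrix and the traces are unchanged. -/

noncomputable section

namespace RadialMass

/-! ### Coordinate frames and change of basis for bilinear forms -/

section Frames

variable {d : ℕ} {H : Type*} [TopologicalSpace H]
  (I : ModelWithCorners ℝ (EuclideanSpace ℝ (Fin d)) H)
  {N : Type*} [TopologicalSpace N] [ChartedSpace H N]

/-- The matrix of a bilinear form in the standard basis of the model space. -/
def stdMatrix (B : EuclideanSpace ℝ (Fin d) →L[ℝ] EuclideanSpace ℝ (Fin d) →L[ℝ] ℝ) :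
    Matrix (Fin d) (Fin d) ℝ :=
  Matrix.of fun A C => B (EuclideanSpace.single A 1) (EuclideanSpace.single C 1)

/-- The derivative of the inverse of the chart at `x₀`, as an endomorphism of the model space. -/
def frameMap (x₀ : N) (y : EuclideanSpace ℝ (Fin d)) :
    EuclideanSpace ℝ (Fin d) →L[ℝ] EuclideanSpace ℝ (Fin d) :=
  mfderivWithin 𝓘(ℝ, EuclideanSpace ℝ (Fin d)) I (extChartAt I x₀).symm (range I) y

/-- The matrix whose columns are the coordinate vectors of the chart at `x₀`. -/
def frameMatrix (x₀ : N) (y : EuclideanSpace ℝ (Fin d)) : Matrix (Fin d) (Fin d) ℝ :=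
  Matrix.of fun A C => frameMap I x₀ y (EuclideanSpace.single C 1) A

theorem sum_smul_single (v : EuclideanSpace ℝ (Fin d)) :
    v = ∑ A, v A • EuclideanSpace.single A (1 : ℝ) := by
  ext C
  simp [Pi.single_apply]

theorem bilin_eq_sum (B : EuclideanSpace ℝ (Fin d) →L[ℝ] EuclideanSpace ℝ (Fin d) →L[ℝ] ℝ)
    (v w : EuclideanSpace ℝ (Fin d)) :
    B v w = ∑ A, ∑ C, v A * w C * stdMatrix B A C := by
  conv_lhs => rw [sum_smul_single v, sum_smul_single w]
  simp only [map_sum, map_smul, sum_apply, smul_apply,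
    smul_eq_mul, stdMatrix, Matrix.of_apply, Finset.mul_sum]
  rw [Finset.sum_comm]
  refine Finset.sum_congr rfl fun A _ => Finset.sum_congr rfl fun C _ => by ring

theorem stdMatrix_injective {B B' : EuclideanSpace ℝ (Fin d) →L[ℝ] EuclideanSpace ℝ (Fin d) →L[ℝ] ℝ}
    (h : stdMatrix B = stdMatrix B') : B = B' := by
  ext v w
  rw [bilin_eq_sum, bilin_eq_sum, h]

/-- The frame depends on the point alone. For a family `G r` all dependence on r thus sits in the
middle factor. -/
theorem coordMatrix_eq_congr (x₀ : N)
    (B : ∀ x : N, TangentSpace I x →L[ℝ] TangentSpace I x →L[ℝ] ℝ)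
    (y : EuclideanSpace ℝ (Fin d)) :
    coordMatrix I x₀ B y = (frameMatrix I x₀ y).transpose *
      stdMatrix (B ((extChartAt I x₀).symm y)) * frameMatrix I x₀ y := by
  ext A C
  simp only [coordMatrix, Matrix.of_apply, Matrix.mul_apply, Matrix.transpose_apply,
    frameMatrix, Finset.sum_mul]
  refine (bilin_eq_sum _ _ _).trans ?_
  rw [Finset.sum_comm]
  refine Finset.sum_congr rfl fun D _ => Finset.sum_congr rfl fun F _ => ?_
  change frameMap I x₀ y _ _ * frameMap I x₀ y _ _ * _ = _
  ring

theorem isUnit_frameMatrix [IsManifold I ∞ N] (x₀ : N) {y : EuclideanSpace ℝ (Fin d)}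
    (hy : y ∈ (extChartAt I x₀).target) : IsUnit (frameMatrix I x₀ y) := by
  have : IsManifold I 1 N := .of_le (n := ∞) (by simp)
  obtain ⟨e, he⟩ := isInvertible_mfderivWithin_extChartAt_symm (I := I) (x := x₀) hy
  have key : frameMatrix I x₀ y = LinearMap.toMatrix (EuclideanSpace.basisFun (Fin d) ℝ).toBasis
      (EuclideanSpace.basisFun (Fin d) ℝ).toBasis
      (frameMap I x₀ y : EuclideanSpace ℝ (Fin d) →ₗ[ℝ] EuclideanSpace ℝ (Fin d)) := by
    ext A C
    simp [frameMatrix, LinearMap.toMatrix_apply]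
  have he' : IsUnit (frameMap I x₀ y : EuclideanSpace ℝ (Fin d) →ₗ[ℝ] EuclideanSpace ℝ (Fin d)) :=
    (Module.End.isUnit_iff _).2 <| by
      have h : ⇑(frameMap I x₀ y) = ⇑e := by rw [frameMap, ← he]; rfl
      rw [ContinuousLinearMap.coe_coe, h]
      exact e.bijective
  rw [key]
  exact (LinearMap.isUnit_toMatrix_iff _).2 he'

/-- The entries of the coordinate matrix of a metric family are smooth in `(r, y)`. -/
theorem IsMetricFamily.contDiffOn_coordMatrix [IsManifold I ∞ N]
    {G : ℝ → ∀ x : N, TangentSpace I x →L[ℝ] TangentSpace I x →L[ℝ] ℝ}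
    (hG : IsMetricFamily I G) (x₀ : N) (A C : Fin d) :
    ContDiffOn ℝ ∞ (fun p : ℝ × EuclideanSpace ℝ (Fin d) => coordMatrix I x₀ (G p.1) p.2 A C)
      (radialDomain I x₀) := by
  rw [← contMDiffOn_iff_contDiffOn]
  have : IsManifold I 1 N := .of_le (n := ∞) (by simp)
  have hsymm : ContMDiffOn 𝓘(ℝ, ℝ × EuclideanSpace ℝ (Fin d)) I ∞
      (fun p : ℝ × EuclideanSpace ℝ (Fin d) => (extChartAt I x₀).symm p.2) (radialDomain I x₀) :=
    (contMDiffOn_extChartAt_symm x₀).comp contDiff_snd.contMDiff.contMDiffOn fun p hp => hp.2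
  have hpair : ContMDiffOn 𝓘(ℝ, ℝ × EuclideanSpace ℝ (Fin d)) (𝓘(ℝ, ℝ).prod I) ∞
      (fun p : ℝ × EuclideanSpace ℝ (Fin d) => (p.1, (extChartAt I x₀).symm p.2))
      (radialDomain I x₀) :=
    contDiff_fst.contMDiff.contMDiffOn.prodMk hsymm
  have hB := hG.smooth.comp hpair fun p hp => ⟨hp.1, mem_univ _⟩
  have hv : ∀ D : Fin d, ContMDiffOn 𝓘(ℝ, ℝ × EuclideanSpace ℝ (Fin d))
      (I.prod 𝓘(ℝ, EuclideanSpace ℝ (Fin d))) ∞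
      (fun p : ℝ × EuclideanSpace ℝ (Fin d) => Bundle.TotalSpace.mk' (EuclideanSpace ℝ (Fin d))
        (E := fun x : N => TangentSpace I x)
        ((extChartAt I x₀).symm p.2) (coordVector I x₀ p.2 D)) (radialDomain I x₀) := by
    intro D
    -- A coordinate vector field is the inverse trivialization of the tangent bundle applied to a
    -- constant vector, hence smooth.
    have h1 := ((trivializationAt (EuclideanSpace ℝ (Fin d)) (TangentSpace I)
      x₀).contMDiffOn_symm (n := ∞) (IB := I)).comp
      (hsymm.prodMk (contMDiffOn_const
        (c := (EuclideanSpace.single D (1 : ℝ) : EuclideanSpace ℝ (Fin d)))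
        (I' := 𝓘(ℝ, EuclideanSpace ℝ (Fin d))))) ?_
    · refine h1.congr fun p hp => ?_
      have hx := (extChartAt I x₀).map_target hp.2
      rw [extChartAt_source] at hx
      have h2 := TangentBundle.symmL_trivializationAt (I := I) hx
      have h3 : coordVector I x₀ p.2 D = (trivializationAt (EuclideanSpace ℝ (Fin d)) (TangentSpace I)
          x₀).symm ((extChartAt I x₀).symm p.2) (EuclideanSpace.single D (1 : ℝ)) := by
        rw [← Bundle.Trivialization.symmL_apply (R := ℝ) _ (by simpa using hx), h2]
        exact congrArg (fun z => frameMap I x₀ z (EuclideanSpace.single D (1 : ℝ)))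
          ((extChartAt I x₀).right_inv hp.2).symm
      rw [h3]
      exact Bundle.Trivialization.mk_symm _ (by simpa using hx) _
    · intro p hp
      have hx := (extChartAt I x₀).map_target hp.2
      simpa [Bundle.Trivialization.mem_target] using hx
  have hval : ContMDiffOn 𝓘(ℝ, ℝ × EuclideanSpace ℝ (Fin d)) (I.prod 𝓘(ℝ, ℝ)) ∞
      (fun p : ℝ × EuclideanSpace ℝ (Fin d) => Bundle.TotalSpace.mk' ℝ (E := Bundle.Trivial N ℝ)
        ((extChartAt I x₀).symm p.2) (coordMatrix I x₀ (G p.1) p.2 A C)) (radialDomain I x₀) :=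
    ContMDiffOn.clm_bundle_apply₂ (F₁ := EuclideanSpace ℝ (Fin d)) (F₂ := EuclideanSpace ℝ (Fin d))
      (F₃ := ℝ) (E₃ := fun _ : N => ℝ) hB (hv A) (hv C)
  intro p hp
  exact ((Bundle.contMDiffWithinAt_totalSpace).1 (hval p hp)).2

end Frames

/-! ### Smoothness of inverses, and the norm of a symmetric form -/

section MatrixLemmas

variable {ι V : Type*} [Fintype ι] [DecidableEq ι] [NormedAddCommGroup V] [NormedSpace ℝ V]

theorem contDiffOn_det {k : WithTop ℕ∞} {s : Set V} {γ : V → Matrix ι ι ℝ}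
    (h : ∀ i j, ContDiffOn ℝ k (fun p => γ p i j) s) :
    ContDiffOn ℝ k (fun p => (γ p).det) s := by
  simp only [Matrix.det_apply']
  exact ContDiffOn.sum fun σ _ => contDiffOn_const.mul (contDiffOn_prod fun i _ => h _ _)

/-- Cramer's rule: the adjugate entries are determinants with one row replaced by a constant row. -/
theorem contDiffOn_inv {k : WithTop ℕ∞} {s : Set V} {γ : V → Matrix ι ι ℝ}
    (h : ∀ i j, ContDiffOn ℝ k (fun p => γ p i j) s) (h0 : ∀ p ∈ s, (γ p).det ≠ 0) (i j : ι) :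
    ContDiffOn ℝ k (fun p => (γ p)⁻¹ i j) s := by
  have hadj : ContDiffOn ℝ k (fun p => (γ p).adjugate i j) s := by
    simp only [Matrix.adjugate_apply]
    refine contDiffOn_det fun a b => ?_
    by_cases hab : a = j
    · subst hab
      simpa using contDiffOn_const
    · simpa [Matrix.updateRow_ne hab] using h a b
  refine (((contDiffOn_det h).inv h0).mul hadj).congr fun p _ => ?_
  simp [Matrix.inv_def, Ring.inverse_eq_inv']

theorem inv_fromBlocks_one {κ : Type*} [Fintype κ] [DecidableEq κ] {A : Matrix ι ι ℝ}
    (hA : IsUnit A.det) :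
    (Matrix.fromBlocks (1 : Matrix κ κ ℝ) 0 0 A)⁻¹ = Matrix.fromBlocks 1 0 0 A⁻¹ := by
  apply Matrix.inv_eq_right_inv
  simp [Matrix.fromBlocks_multiply, Matrix.mul_nonsing_inv _ hA]

-- Write γ⁻¹ = BᵀB and move one factor around the trace. The right side is a sum of squares, which
-- yields both positivity and the equality case.
open scoped MatrixOrder Matrix.Norms.L2Operator in
theorem exists_trace_sq_eq {γ τ : Matrix ι ι ℝ} (hγ : γ.PosDef) (hτ : τ.IsSymm) :
    ∃ B : Matrix ι ι ℝ, IsUnit B ∧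
      (γ⁻¹ * τ * (γ⁻¹ * τ)).trace =
        ((B * τ * B.transpose).transpose * (B * τ * B.transpose)).trace := by
  obtain ⟨B, h⟩ := CStarAlgebra.nonneg_iff_eq_star_mul_self.mp hγ.inv.posSemidef.nonneg
  have hB : IsUnit B := by
    have hu := hγ.inv.isUnit
    rw [h, Matrix.isUnit_iff_isUnit_det, Matrix.det_mul] at hu
    exact (Matrix.isUnit_iff_isUnit_det B).2 (isUnit_of_mul_isUnit_right hu)
  refine ⟨B, hB, ?_⟩
  rw [h, Matrix.star_eq_conjTranspose, Matrix.conjTranspose_eq_transpose_of_trivial]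
  simp only [Matrix.transpose_mul, Matrix.transpose_transpose, hτ.eq]
  rw [Matrix.mul_assoc, Matrix.mul_assoc, Matrix.trace_mul_comm]
  simp only [← Matrix.mul_assoc]

/-- The square of the norm of a symmetric bilinear form is nonnegative. -/
theorem trace_sq_nonneg {γ τ : Matrix ι ι ℝ} (hγ : γ.PosDef) (hτ : τ.IsSymm) :
    0 ≤ (γ⁻¹ * τ * (γ⁻¹ * τ)).trace := by
  obtain ⟨B, -, h⟩ := exists_trace_sq_eq hγ hτ
  rw [h, ← Matrix.conjTranspose_eq_transpose_of_trivial]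
  exact (Matrix.posSemidef_conjTranspose_mul_self _).trace_nonneg

/-- A vanishing sum of squares gives BτBᵀ = 0, and B is invertible. -/
theorem eq_zero_of_trace_sq {γ τ : Matrix ι ι ℝ} (hγ : γ.PosDef) (hτ : τ.IsSymm)
    (h0 : (γ⁻¹ * τ * (γ⁻¹ * τ)).trace = 0) : τ = 0 := by
  obtain ⟨B, hB, h⟩ := exists_trace_sq_eq hγ hτ
  rw [h, ← Matrix.conjTranspose_eq_transpose_of_trivial,
    Matrix.trace_conjTranspose_mul_self_eq_zero_iff] at h0
  have hB' : IsUnit B.transpose := by simpa using hB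
  have h1 := (hB'.mul_left_eq_zero).1 h0
  exact (hB.mul_right_eq_zero).1 h1

end MatrixLemmas

/-! ### The Riccati equation for dr² + γ in coordinates -/

section RadialCoordinates

variable {d : ℕ} {T : Set (EuclideanSpace ℝ (Fin d))}
  {γ : ℝ × EuclideanSpace ℝ (Fin d) → Matrix (Fin d) (Fin d) ℝ}

/-- `T` may have boundary, but r is interior to (0, ∞), so the derivative within the domain
restricts to a genuine derivative along the ray. -/
theorem hasDerivAt_radial {f : ℝ × EuclideanSpace ℝ (Fin d) → ℝ} {r : ℝ}
    {y : EuclideanSpace ℝ (Fin d)} (hr : 0 < r) (hy : y ∈ T)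
    (hf : DifferentiableWithinAt ℝ f (Ioi 0 ×ˢ T) (r, y)) :
    HasDerivAt (fun t => f (t, y)) (pderiv radialBasis (Ioi 0 ×ˢ T) (Sum.inl ()) f (r, y)) r := by
  have hl : HasDerivWithinAt (fun t : ℝ => (t, y)) ((1 : ℝ), (0 : EuclideanSpace ℝ (Fin d)))
      (Ioi 0) r := ((hasDerivAt_id r).prodMk (hasDerivAt_const r y)).hasDerivWithinAt
  have hmaps : MapsTo (fun t : ℝ => (t, y)) (Ioi 0) (Ioi 0 ×ˢ T) := fun t ht => ⟨ht, hy⟩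
  exact (hf.hasFDerivWithinAt.comp_hasDerivWithinAt r hl hmaps).hasDerivAt
    (Ioi_mem_nhds hr)

/-- The Weingarten matrix `½ γ⁻¹ ∂_r γ` of the level sets of `r` for `dr² + γ`. -/
def weingarten (T : Set (EuclideanSpace ℝ (Fin d)))
    (γ : ℝ × EuclideanSpace ℝ (Fin d) → Matrix (Fin d) (Fin d) ℝ)
    (p : ℝ × EuclideanSpace ℝ (Fin d)) : Matrix (Fin d) (Fin d) ℝ :=
  (1 / 2 : ℝ) • ((γ p)⁻¹ *
    Matrix.of fun A C => pderiv radialBasis (Ioi 0 ×ˢ T) (Sum.inl ()) (fun q => γ q C A) p)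

theorem pderiv_const {ι V : Type*} [NormedAddCommGroup V] [NormedSpace ℝ V] (b : ι → V) (s : Set V)
    (i : ι) (c : ℝ) (p : V) : pderiv b s i (fun _ => c) p = 0 := by
  simp [pderiv]

theorem christoffel_radial_radial (k : Unit ⊕ Fin d) (p : ℝ × EuclideanSpace ℝ (Fin d)) :
    christoffel radialBasis (Ioi 0 ×ˢ T) (fun q => Matrix.fromBlocks 1 0 0 (γ q)) k (Sum.inl ())
      (Sum.inl ()) p = 0 := by
  simp [christoffel, pderiv_const]

theorem christoffel_radial_left {p : ℝ × EuclideanSpace ℝ (Fin d)} (hp : IsUnit (γ p).det)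
    (k : Unit ⊕ Fin d) :
    christoffel radialBasis (Ioi 0 ×ˢ T) (fun q => Matrix.fromBlocks 1 0 0 (γ q)) (Sum.inl ())
      (Sum.inl ()) k p = 0 := by
  cases k <;> simp [christoffel, pderiv_const, inv_fromBlocks_one hp]

/-- Since g_rr and g_rA are constant, only the ∂_r γ term survives. The index order in `weingarten`
is the one produced here, so symmetry of γ plays no role. -/
theorem christoffel_weingarten {p : ℝ × EuclideanSpace ℝ (Fin d)} (hp : IsUnit (γ p).det)
    (A C : Fin d) :
    christoffel radialBasis (Ioi 0 ×ˢ T) (fun q => Matrix.fromBlocks 1 0 0 (γ q)) (Sum.inr A)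
      (Sum.inl ()) (Sum.inr C) p = weingarten T γ p A C := by
  simp [christoffel, pderiv_const, inv_fromBlocks_one hp, weingarten, Matrix.mul_apply]

theorem christoffel_weingarten' {p : ℝ × EuclideanSpace ℝ (Fin d)} (hp : IsUnit (γ p).det)
    (A C : Fin d) :
    christoffel radialBasis (Ioi 0 ×ˢ T) (fun q => Matrix.fromBlocks 1 0 0 (γ q)) (Sum.inr A)
      (Sum.inr C) (Sum.inl ()) p = weingarten T γ p A C := by
  simp [christoffel, pderiv_const, inv_fromBlocks_one hp, weingarten, Matrix.mul_apply]

theorem pderiv_congr {ι V : Type*} [NormedAddCommGroup V] [NormedSpace ℝ V] {b : ι → V} {s : Set V}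
    {i : ι} {f g : V → ℝ} (h : EqOn f g s) {p : V} (hp : p ∈ s) :
    pderiv b s i f p = pderiv b s i g p := by
  rw [pderiv, pderiv, fderivWithin_congr h (h hp)]

/-- The Riccati equation: `R_{rr} = -∂_r tr S - tr S²`. -/
theorem ricci_radial (hγ : ∀ p ∈ Ioi 0 ×ˢ T, IsUnit (γ p).det)
    {p : ℝ × EuclideanSpace ℝ (Fin d)} (hp : p ∈ Ioi (0 : ℝ) ×ˢ T) :
    ricci radialBasis (Ioi 0 ×ˢ T) (fun q => Matrix.fromBlocks 1 0 0 (γ q)) (Sum.inl ())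
      (Sum.inl ()) p =
    -∑ A, pderiv radialBasis (Ioi 0 ×ˢ T) (Sum.inl ()) (fun q => weingarten T γ q A A) p
      - (weingarten T γ p * weingarten T γ p).trace := by
  have h0 : ∀ k : Unit ⊕ Fin d, christoffel radialBasis (Ioi 0 ×ˢ T)
      (fun q => Matrix.fromBlocks 1 0 0 (γ q)) k (Sum.inl ()) (Sum.inl ()) = fun _ => 0 :=
    fun k => funext (christoffel_radial_radial k)
  -- These symbols get differentiated, so their formula is needed on the whole domain and not only
  -- at `p`.
  have h1 : ∀ k, pderiv radialBasis (Ioi 0 ×ˢ T) (Sum.inl ()) (christoffel radialBasis (Ioi 0 ×ˢ T)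
      (fun q => Matrix.fromBlocks 1 0 0 (γ q)) (Sum.inr k) (Sum.inl ()) (Sum.inr k)) p =
      pderiv radialBasis (Ioi 0 ×ˢ T) (Sum.inl ()) (fun q => weingarten T γ q k k) p :=
    fun k => pderiv_congr (fun q hq => christoffel_weingarten (hγ q hq) k k) hp
  simp only [ricci, h0, pderiv_const, Fintype.sum_sum_type, h1]
  simp [christoffel_radial_left (hγ p hp), christoffel_weingarten (hγ p hp), Matrix.trace,
    Matrix.mul_apply]
  ring

theorem contDiffOn_pderiv {s : Set (ℝ × EuclideanSpace ℝ (Fin d))} (hs : UniqueDiffOn ℝ s)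
    {f : ℝ × EuclideanSpace ℝ (Fin d) → ℝ} (hf : ContDiffOn ℝ ∞ f s) (i : Unit ⊕ Fin d) :
    ContDiffOn ℝ ∞ (pderiv radialBasis s i f) s :=
  (hf.fderivWithin hs (by simp)).clm_apply contDiffOn_const

theorem contDiffOn_weingarten (hT : UniqueDiffOn ℝ T)
    (hsm : ∀ A C, ContDiffOn ℝ ∞ (fun p => γ p A C) (Ioi 0 ×ˢ T))
    (hγ : ∀ p ∈ Ioi 0 ×ˢ T, IsUnit (γ p).det) (A C : Fin d) :
    ContDiffOn ℝ ∞ (fun p => weingarten T γ p A C) (Ioi 0 ×ˢ T) := by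
  simp only [weingarten, Matrix.smul_apply, Matrix.mul_apply, Matrix.of_apply, smul_eq_mul]
  refine contDiffOn_const.mul (ContDiffOn.sum fun D _ => ?_)
  exact (contDiffOn_inv hsm (fun p hp => (hγ p hp).ne_zero) A D).mul
    (contDiffOn_pderiv ((uniqueDiffOn_Ioi 0).prod hT) (hsm _ _) _)

end RadialCoordinates

/-! ### Weingarten map, defect and radial mass of a metric family -/

section SmoothFamilies

variable {d : ℕ} {H : Type*} [TopologicalSpace H]
  (I : ModelWithCorners ℝ (EuclideanSpace ℝ (Fin d)) H)
  {N : Type*} [TopologicalSpace N] [ChartedSpace H N]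

/-- A family of metrics whose coordinate matrices are smooth in `(r, y)`. -/
structure IsSmoothFamily
    (G : ℝ → ∀ x : N, TangentSpace I x →L[ℝ] TangentSpace I x →L[ℝ] ℝ) : Prop where
  symm : ∀ r > 0, ∀ (x : N) (v w : TangentSpace I x), G r x v w = G r x w v
  pos : ∀ r > 0, ∀ (x : N) (v : TangentSpace I x), v ≠ 0 → 0 < G r x v v
  coord : ∀ (x₀ : N) (A C : Fin d), ContDiffOn ℝ ∞
    (fun p : ℝ × EuclideanSpace ℝ (Fin d) => coordMatrix I x₀ (G p.1) p.2 A C) (radialDomain I x₀)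

variable {I} {G : ℝ → ∀ x : N, TangentSpace I x →L[ℝ] TangentSpace I x →L[ℝ] ℝ}

/-- Smoothness of coordinate matrices is the form used by the analysis; it passes at once from B to
r² B. -/
theorem IsMetricFamily.isSmoothFamily [IsManifold I ∞ N] (hG : IsMetricFamily I G) :
    IsSmoothFamily I G :=
  ⟨hG.symm, hG.pos, hG.contDiffOn_coordMatrix⟩

theorem stdMatrix_posDef {B : EuclideanSpace ℝ (Fin d) →L[ℝ] EuclideanSpace ℝ (Fin d) →L[ℝ] ℝ}
    (hs : ∀ v w, B v w = B w v) (hp : ∀ v, v ≠ 0 → 0 < B v v) : (stdMatrix B).PosDef := by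
  refine Matrix.PosDef.of_dotProduct_mulVec_pos ?_ fun v hv => ?_
  · ext A C
    simp [stdMatrix, hs (EuclideanSpace.single A 1)]
  · have h := hp (WithLp.toLp 2 v) (by simpa using hv)
    rw [bilin_eq_sum] at h
    simpa [dotProduct, Matrix.mulVec, Finset.mul_sum, mul_comm, mul_left_comm, mul_assoc] using h

namespace IsSmoothFamily

theorem posDef (hG : IsSmoothFamily I G) {r : ℝ} (hr : 0 < r) (x : N) :
    (stdMatrix (G r x)).PosDef :=
  stdMatrix_posDef (hG.symm r hr x) (hG.pos r hr x)

theorem isSymm_stdMatrix (hG : IsSmoothFamily I G) {r : ℝ} (hr : 0 < r) (x : N) :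
    (stdMatrix (G r x)).IsSymm := by
  ext A C
  exact hG.symm r hr x _ _

theorem isUnit_coordMatrix [IsManifold I ∞ N] (hG : IsSmoothFamily I G) (x₀ : N)
    {p : ℝ × EuclideanSpace ℝ (Fin d)} (hp : p ∈ Ioi (0 : ℝ) ×ˢ (extChartAt I x₀).target) :
    IsUnit (coordMatrix I x₀ (G p.1) p.2).det := by
  rw [← Matrix.isUnit_iff_isUnit_det, coordMatrix_eq_congr]
  have hF := isUnit_frameMatrix I x₀ hp.2
  have hF' : IsUnit (frameMatrix I x₀ p.2).transpose := by simpa using hF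
  exact (hF'.mul (hG.posDef hp.1 _).isUnit).mul hF

end IsSmoothFamily

variable (I G) in
/-- The entrywise `r`-derivative of the matrix of `G(r)` in the standard basis. -/
def stdDeriv (r : ℝ) (x : N) : Matrix (Fin d) (Fin d) ℝ :=
  Matrix.of fun A C => deriv (fun t => stdMatrix (G t x) A C) r

variable (I G) in
/-- The Weingarten map `½ G⁻¹ ∂_r G` in the standard basis. -/
def shape (r : ℝ) (x : N) : Matrix (Fin d) (Fin d) ℝ :=
  (1 / 2 : ℝ) • ((stdMatrix (G r x))⁻¹ * stdDeriv I G r x)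

variable (I G) in
/-- The Weingarten matrix in the chart at `x₀`. -/
def chartShape (x₀ : N) (p : ℝ × EuclideanSpace ℝ (Fin d)) : Matrix (Fin d) (Fin d) ℝ :=
  weingarten (extChartAt I x₀).target (fun q => coordMatrix I x₀ (G q.1) q.2) p

/-- The tangent space at x is identified with the model space through the preferred chart at x.
Quantities defined in that chart at x can therefore be computed with `stdMatrix`. -/
theorem frameMatrix_self [IsManifold I ∞ N] (x : N) : frameMatrix I x (extChartAt I x x) = 1 := by
  have : IsManifold I 1 N := .of_le (n := ∞) (by simp)
  ext A C
  have h : frameMap I x (extChartAt I x x) = ContinuousLinearMap.id ℝ _ :=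
    mfderivWithin_range_extChartAt_symm
  simp only [frameMatrix, h, Matrix.of_apply, ContinuousLinearMap.id_apply, Matrix.one_apply]
  simp

theorem coordMatrix_self [IsManifold I ∞ N] (x : N)
    (B : ∀ x : N, TangentSpace I x →L[ℝ] TangentSpace I x →L[ℝ] ℝ) :
    coordMatrix I x B (extChartAt I x x) = stdMatrix (B x) := by
  rw [coordMatrix_eq_congr, frameMatrix_self]
  simp only [Matrix.transpose_one, one_mul, mul_one]
  exact congrArg (fun z => stdMatrix (d := d) (B z)) (extChartAt_to_inv x)

theorem coordMatrix_extChartAt (x₀ : N) {x : N} (hx : x ∈ (extChartAt I x₀).source)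
    (B : ∀ x : N, TangentSpace I x →L[ℝ] TangentSpace I x →L[ℝ] ℝ) :
    coordMatrix I x₀ B (extChartAt I x₀ x) = (frameMatrix I x₀ (extChartAt I x₀ x)).transpose *
      stdMatrix (B x) * frameMatrix I x₀ (extChartAt I x₀ x) := by
  rw [coordMatrix_eq_congr]
  congr 2
  exact congrArg (fun z => stdMatrix (d := d) (B z)) ((extChartAt I x₀).left_inv hx)

namespace IsSmoothFamily

variable [IsManifold I ∞ N]

theorem contDiffOn_stdMatrix (hG : IsSmoothFamily I G) (x : N) (A C : Fin d) :
    ContDiffOn ℝ ∞ (fun t => stdMatrix (G t x) A C) (Ioi 0) := by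
  have h := (hG.coord x A C).comp (g := fun p : ℝ × EuclideanSpace ℝ (Fin d) => _)
    (f := fun t : ℝ => (t, extChartAt I x x)) (s := Ioi 0)
    (contDiff_id.prodMk contDiff_const).contDiffOn fun t ht => ⟨ht, mem_extChartAt_target x⟩
  exact h.congr fun t _ => by rw [Function.comp_apply, coordMatrix_self]

theorem hasDerivAt_stdMatrix (hG : IsSmoothFamily I G) {r : ℝ} (hr : 0 < r) (x : N) (A C : Fin d) :
    HasDerivAt (fun t => stdMatrix (G t x) A C) (stdDeriv I G r x A C) r :=
  (((hG.contDiffOn_stdMatrix x A C).differentiableOn (by simp)).differentiableAt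
    (Ioi_mem_nhds hr)).hasDerivAt

omit [IsManifold I ∞ N] in
theorem isSymm_stdDeriv (hG : IsSmoothFamily I G) {r : ℝ} (hr : 0 < r) (x : N) :
    (stdDeriv I G r x).IsSymm := by
  ext A C
  refine Filter.EventuallyEq.deriv_eq ?_
  filter_upwards [Ioi_mem_nhds hr] with t ht
  exact (hG.isSymm_stdMatrix ht x).apply A C

/-- The frame F is independent of r, so γ = FᵀGF gives ½ γ⁻¹ ∂_r γ = F⁻¹SF. Conjugation invariants
of S can thus be read off in any fixed chart. -/
theorem chartShape_eq (hG : IsSmoothFamily I G) (x₀ : N) {x : N}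
    (hx : x ∈ (extChartAt I x₀).source) {r : ℝ} (hr : 0 < r) :
    chartShape I G x₀ (r, extChartAt I x₀ x) =
      (frameMatrix I x₀ (extChartAt I x₀ x))⁻¹ * shape I G r x *
        frameMatrix I x₀ (extChartAt I x₀ x) := by
  have hy := (extChartAt I x₀).map_source hx
  set y := extChartAt I x₀ x with hy_def
  set F := frameMatrix I x₀ y
  have hF : IsUnit F.det := (Matrix.isUnit_iff_isUnit_det _).1 (isUnit_frameMatrix I x₀ hy)
  have hFt : IsUnit F.transpose.det := by rwa [Matrix.det_transpose]
  have hd : (Matrix.of fun A C => pderiv radialBasis (Ioi 0 ×ˢ (extChartAt I x₀).target)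
      (Sum.inl ()) (fun q => coordMatrix I x₀ (G q.1) q.2 C A) (r, y)) =
      F.transpose * stdDeriv I G r x * F := by
    -- The entries of the derivative matrix are indexed in transposed order; symmetry of ∂_r G
    -- absorbs this.
    rw [← (hG.isSymm_stdDeriv hr x).eq]
    ext A C
    have h1 := hasDerivAt_radial hr hy
      (((hG.coord x₀ C A).differentiableOn (by simp)) (r, y) ⟨hr, hy⟩)
    simp only [Matrix.of_apply]
    refine h1.unique ?_
    have h2 : (fun t => coordMatrix I x₀ (G t) y C A) =
        fun t => ∑ E, ∑ D, F D C * stdMatrix (G t x) D E * F E A := by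
      funext t
      rw [hy_def, coordMatrix_extChartAt x₀ hx]
      simp only [Matrix.mul_apply, Matrix.transpose_apply, Finset.sum_mul]
      rfl
    simp only [h2]
    have h3 : (F.transpose * (stdDeriv I G r x).transpose * F) A C =
        ∑ E, ∑ D, F D C * stdDeriv I G r x D E * F E A := by
      simp only [Matrix.mul_apply, Matrix.transpose_apply, Finset.sum_mul]
      rw [Finset.sum_comm]
      refine Finset.sum_congr rfl fun E _ => Finset.sum_congr rfl fun D _ => ?_
      ring
    rw [h3]
    exact HasDerivAt.fun_sum fun E _ => HasDerivAt.fun_sum fun D _ =>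
      ((hG.hasDerivAt_stdMatrix hr x D E).const_mul _).mul_const _
  rw [chartShape, weingarten, hd]
  simp only
  rw [hy_def, coordMatrix_extChartAt x₀ hx, ← hy_def, shape, Matrix.mul_inv_rev, Matrix.mul_inv_rev]
  simp only [Matrix.mul_smul, Matrix.smul_mul, Matrix.mul_assoc]
  rw [Matrix.nonsing_inv_mul_cancel_left _ _ hFt]

theorem contDiffOn_chartShape (hG : IsSmoothFamily I G) (x₀ : N) (A C : Fin d) :
    ContDiffOn ℝ ∞ (fun p => chartShape I G x₀ p A C) (radialDomain I x₀) :=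
  contDiffOn_weingarten (uniqueDiffOn_extChartAt_target x₀) (hG.coord x₀)
    (fun _ hp => hG.isUnit_coordMatrix x₀ hp) A C

theorem chartShape_self (hG : IsSmoothFamily I G) (x : N) {r : ℝ} (hr : 0 < r) :
    chartShape I G x (r, extChartAt I x x) = shape I G r x := by
  rw [hG.chartShape_eq x (mem_extChartAt_source x) hr, frameMatrix_self]
  simp

theorem contDiffOn_shape (hG : IsSmoothFamily I G) (x : N) (A C : Fin d) :
    ContDiffOn ℝ ∞ (fun t => shape I G t x A C) (Ioi 0) := by
  have h := (hG.contDiffOn_chartShape x A C).comp (g := fun p : ℝ × EuclideanSpace ℝ (Fin d) => _)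
    (f := fun t : ℝ => (t, extChartAt I x x)) (s := Ioi 0)
    (contDiff_id.prodMk contDiff_const).contDiffOn fun t ht => ⟨ht, mem_extChartAt_target x⟩
  exact h.congr fun t ht => by rw [Function.comp_apply, hG.chartShape_self x ht]

theorem meanCurvature_eq (hG : IsSmoothFamily I G) {r : ℝ} (hr : 0 < r) (x : N) :
    meanCurvature I G r x = (shape I G r x).trace := by
  rw [← hG.chartShape_self x hr]
  refine Finset.sum_congr rfl fun A _ => ?_
  exact christoffel_weingarten' (γ := fun q => coordMatrix I x (G q.1) q.2)
    (hG.isUnit_coordMatrix x (p := (r, extChartAt I x x)) ⟨hr, mem_extChartAt_target x⟩) A A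

theorem hasDerivAt_trace_shape (hG : IsSmoothFamily I G) {r : ℝ} (hr : 0 < r) (x : N) :
    HasDerivAt (fun t => (shape I G t x).trace)
      (-radialRicci I G r x - (shape I G r x * shape I G r x).trace) r := by
  have hp : (r, extChartAt I x x) ∈ Ioi (0 : ℝ) ×ˢ (extChartAt I x).target :=
    ⟨hr, mem_extChartAt_target x⟩
  have hR := ricci_radial (γ := fun q => coordMatrix I x (G q.1) q.2)
    (fun _ hp => hG.isUnit_coordMatrix x hp) hp
  have h : HasDerivAt (fun t => (chartShape I G x (t, extChartAt I x x)).trace)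
      (∑ A, pderiv radialBasis (Ioi 0 ×ˢ (extChartAt I x).target) (Sum.inl ())
        (fun q => chartShape I G x q A A) (r, extChartAt I x x)) r :=
    HasDerivAt.fun_sum fun A _ => hasDerivAt_radial hr (mem_extChartAt_target x)
      (((hG.contDiffOn_chartShape x A A).differentiableOn (by simp)) _ hp)
  have h' := h.congr_of_eventuallyEq (f₁ := fun t => (shape I G t x).trace) (by
    filter_upwards [Ioi_mem_nhds hr] with t ht
    rw [hG.chartShape_self x ht])
  convert! h' using 1
  rw [← hG.chartShape_self x hr]
  have : radialRicci I G r x = _ := hR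
  rw [this]
  simp [chartShape]

end IsSmoothFamily

/-! ### Conjugation invariance and continuity on (0, ∞) × N -/

theorem trace_conj {F S : Matrix (Fin d) (Fin d) ℝ} (hF : IsUnit F.det) :
    (F⁻¹ * S * F).trace = S.trace := by
  rw [Matrix.trace_mul_comm, Matrix.mul_nonsing_inv_cancel_left _ _ hF]

theorem trace_conj_sub_sq {F S : Matrix (Fin d) (Fin d) ℝ} (hF : IsUnit F.det) (c : ℝ) :
    ((F⁻¹ * S * F - c • 1) * (F⁻¹ * S * F - c • 1)).trace =
      ((S - c • 1) * (S - c • 1)).trace := by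
  have h : F⁻¹ * S * F - c • 1 = F⁻¹ * (S - c • 1) * F := by
    rw [Matrix.mul_sub, Matrix.sub_mul, Matrix.mul_smul, mul_one, Matrix.smul_mul,
      Matrix.nonsing_inv_mul _ hF]
  have h2 : F⁻¹ * (S - c • 1) * F * (F⁻¹ * (S - c • 1) * F) =
      F⁻¹ * ((S - c • 1) * (S - c • 1)) * F := by
    simp only [Matrix.mul_assoc]
    rw [Matrix.mul_nonsing_inv_cancel_left _ _ hF]
  rw [h, h2, trace_conj hF]

/-- A function on `(0, ∞) × N` is continuous if it is so in the coordinates of every chart. -/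
theorem continuousOn_of_charts {f : ℝ × N → ℝ}
    (h : ∀ x₀ : N, ∃ g : ℝ × EuclideanSpace ℝ (Fin d) → ℝ, ContinuousOn g (radialDomain I x₀) ∧
      ∀ r > 0, ∀ x ∈ (extChartAt I x₀).source, f (r, x) = g (r, extChartAt I x₀ x)) :
    ContinuousOn f (Ioi 0 ×ˢ univ) := by
  rintro ⟨r, x⟩ hr
  obtain ⟨g, hg, hfg⟩ := h x
  have hc : ContinuousOn (fun p : ℝ × N => g (p.1, extChartAt I x p.2))
      (Ioi 0 ×ˢ (extChartAt I x).source) := by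
    refine hg.comp (continuousOn_fst.prodMk
      ((continuousOn_extChartAt x).comp continuousOn_snd fun p hp => hp.2)) fun p hp =>
      ⟨hp.1, (extChartAt I x).map_source hp.2⟩
  have ho : IsOpen (Ioi (0 : ℝ) ×ˢ (extChartAt I x).source) :=
    isOpen_Ioi.prod (isOpen_extChartAt_source x)
  have hc' := (hc.congr (g := f) fun p hp => hfg p.1 hp.1 p.2 hp.2).continuousAt
    (ho.mem_nhds ⟨hr.1, mem_extChartAt_source x⟩)
  exact hc'.continuousWithinAt

variable (I G) in
/-- The squared distance `|S - r⁻¹ id|²` of the Weingarten map to that of a cone. -/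
def defect (r : ℝ) (x : N) : ℝ :=
  ((shape I G r x - (1 / r) • 1) * (shape I G r x - (1 / r) • 1)).trace

theorem defect_expand (r : ℝ) (x : N) : defect I G r x =
    (shape I G r x * shape I G r x).trace - 2 / r * (shape I G r x).trace + d / r ^ 2 := by
  have h : (1 : Matrix (Fin d) (Fin d) ℝ).trace = d := by simp
  simp only [defect, Matrix.sub_mul, Matrix.mul_sub, Matrix.smul_mul, Matrix.mul_smul, one_mul,
    mul_one, Matrix.trace_sub, Matrix.trace_smul, smul_eq_mul, h]
  ring

variable [IsManifold I ∞ N]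

namespace IsSmoothFamily

theorem continuousOn_chartShape (hG : IsSmoothFamily I G) (x₀ : N) :
    ContinuousOn (chartShape I G x₀) (radialDomain I x₀) :=
  continuousOn_pi.2 fun A => continuousOn_pi.2 fun C => (hG.contDiffOn_chartShape x₀ A C).continuousOn

theorem continuousOn_meanCurvature (hG : IsSmoothFamily I G) :
    ContinuousOn (fun p : ℝ × N => meanCurvature I G p.1 p.2) (Ioi 0 ×ˢ univ) := by
  refine continuousOn_of_charts (I := I) fun x₀ => ⟨fun q => (chartShape I G x₀ q).trace, ?_, ?_⟩
  · exact (continuous_id.matrix_trace).comp_continuousOn (hG.continuousOn_chartShape x₀)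
  · intro r hr x hx
    dsimp only
    rw [hG.chartShape_eq x₀ hx hr, trace_conj, hG.meanCurvature_eq hr]
    exact (Matrix.isUnit_iff_isUnit_det _).1
      (isUnit_frameMatrix I x₀ ((extChartAt I x₀).map_source hx))

theorem continuousOn_defect (hG : IsSmoothFamily I G) :
    ContinuousOn (fun p : ℝ × N => defect I G p.1 p.2) (Ioi 0 ×ˢ univ) := by
  refine continuousOn_of_charts (I := I) fun x₀ => ⟨fun q =>
    ((chartShape I G x₀ q - (1 / q.1) • 1) * (chartShape I G x₀ q - (1 / q.1) • 1)).trace, ?_, ?_⟩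
  · have h : ContinuousOn (fun q : ℝ × EuclideanSpace ℝ (Fin d) =>
        chartShape I G x₀ q - (1 / q.1) • (1 : Matrix (Fin d) (Fin d) ℝ)) (radialDomain I x₀) :=
      (hG.continuousOn_chartShape x₀).sub
        ((continuousOn_const.div continuousOn_fst fun q hq => (mem_Ioi.1 hq.1).ne').smul
          continuousOn_const)
    exact (continuous_id.matrix_trace).comp_continuousOn
      ((continuous_fst.matrix_mul continuous_snd).comp_continuousOn (h.prodMk h))
  · intro r hr x hx
    dsimp only
    rw [hG.chartShape_eq x₀ hx hr]
    refine (trace_conj_sub_sq ?_ _).symm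
    exact (Matrix.isUnit_iff_isUnit_det _).1
      (isUnit_frameMatrix I x₀ ((extChartAt I x₀).map_source hx))

-- Factoring out G⁻¹ leaves a symmetric matrix, so the trace lemmas apply with γ = G.
omit [IsManifold I ∞ N] in
theorem shape_sub (hG : IsSmoothFamily I G) {r : ℝ} (hr : 0 < r) (x : N) :
    shape I G r x - (1 / r) • 1 =
      (stdMatrix (G r x))⁻¹ * ((1 / 2 : ℝ) • stdDeriv I G r x - (1 / r) • stdMatrix (G r x)) := by
  have hu := (Matrix.isUnit_iff_isUnit_det _).1 (hG.posDef hr x).isUnit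
  rw [shape, Matrix.mul_sub, Matrix.mul_smul, Matrix.mul_smul, Matrix.nonsing_inv_mul _ hu]

omit [IsManifold I ∞ N] in
theorem isSymm_sub (hG : IsSmoothFamily I G) {r : ℝ} (hr : 0 < r) (x : N) :
    ((1 / 2 : ℝ) • stdDeriv I G r x - (1 / r) • stdMatrix (G r x)).IsSymm :=
  ((hG.isSymm_stdDeriv hr x).smul _).sub ((hG.isSymm_stdMatrix hr x).smul _)

omit [IsManifold I ∞ N] in
theorem defect_nonneg (hG : IsSmoothFamily I G) {r : ℝ} (hr : 0 < r) (x : N) :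
    0 ≤ defect I G r x := by
  rw [defect, hG.shape_sub hr]
  exact trace_sq_nonneg (hG.posDef hr x) (hG.isSymm_sub hr x)

omit [IsManifold I ∞ N] in
theorem stdDeriv_of_defect_eq_zero (hG : IsSmoothFamily I G) {r : ℝ} (hr : 0 < r) {x : N}
    (h0 : defect I G r x = 0) : stdDeriv I G r x = (2 / r) • stdMatrix (G r x) := by
  rw [defect, hG.shape_sub hr] at h0
  have h := sub_eq_zero.1 (eq_zero_of_trace_sq (hG.posDef hr x) (hG.isSymm_sub hr x) h0)
  calc stdDeriv I G r x = (2 : ℝ) • ((1 / 2 : ℝ) • stdDeriv I G r x) := by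
        rw [smul_smul]; norm_num
    _ = _ := by rw [h, smul_smul]; congr 1; ring

/-- If the defect vanishes along the ray through `x`, then `G(r) = r² G(1)` there. -/
theorem eq_sq_smul_of_defect (hG : IsSmoothFamily I G) {x : N}
    (h0 : ∀ r > 0, defect I G r x = 0) {r : ℝ} (hr : 0 < r) : G r x = r ^ 2 • G 1 x := by
  apply stdMatrix_injective
  ext A C
  -- The equation ∂_r G = (2/r) G says that G/r² is constant.
  have hderiv : ∀ t ∈ Ioi (0 : ℝ),
      HasDerivAt (fun t => stdMatrix (G t x) A C / t ^ 2) 0 t := by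
    intro t ht
    have ht' : t ≠ 0 := (mem_Ioi.1 ht).ne'
    have h := (hG.hasDerivAt_stdMatrix ht x A C).div (hasDerivAt_pow 2 t) (pow_ne_zero 2 ht')
    refine h.congr_deriv ?_
    rw [hG.stdDeriv_of_defect_eq_zero ht (h0 t ht)]
    simp only [Matrix.smul_apply, smul_eq_mul]
    field_simp
    push_cast
    ring
  have hconst := isOpen_Ioi.is_const_of_deriv_eq_zero isPreconnected_Ioi
    (fun t ht => (hderiv t ht).differentiableAt.differentiableWithinAt)
    (fun t ht => (hderiv t ht).deriv) (mem_Ioi.2 hr) (mem_Ioi.2 one_pos)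
  have hr' : r ^ 2 ≠ 0 := by positivity
  simp only [one_pow, div_one] at hconst
  rw [div_eq_iff hr'] at hconst
  rw [hconst]
  change _ = r ^ 2 * (stdMatrix (G 1 x) A C)
  ring

-- Used twice: for g₀ it gives H₀ = d/r, and in the equality case it makes the defect of a cone
-- vanish.
omit [IsManifold I ∞ N] in
theorem shape_of_conical (hG : IsSmoothFamily I G) {x : N}
    {B : TangentSpace I x →L[ℝ] TangentSpace I x →L[ℝ] ℝ}
    (h : ∀ t > 0, G t x = t ^ 2 • B) {r : ℝ} (hr : 0 < r) :
    shape I G r x = (1 / r) • 1 := by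
  have hd : stdDeriv I G r x = (2 / r) • stdMatrix (G r x) := by
    ext A C
    have hB : ∀ t > 0, stdMatrix (G t x) A C = t ^ 2 * stdMatrix (d := d) B A C := by
      intro t ht
      rw [h t ht]
      rfl
    have h1 : (fun t => stdMatrix (G t x) A C) =ᶠ[𝓝 r]
        fun t => t ^ 2 * stdMatrix (d := d) B A C := by
      filter_upwards [Ioi_mem_nhds hr] with t ht using hB t ht
    simp only [stdDeriv, Matrix.of_apply, h1.deriv_eq, Matrix.smul_apply, hB r hr, smul_eq_mul]
    rw [((hasDerivAt_pow 2 r).mul_const _).deriv]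
    field_simp
    push_cast
    ring
  have hu := (Matrix.isUnit_iff_isUnit_det _).1 (hG.posDef hr x).isUnit
  rw [shape, hd, Matrix.mul_smul, Matrix.nonsing_inv_mul _ hu, smul_smul]
  congr 1
  ring

omit [IsManifold I ∞ N] in
theorem warped {B : ∀ x : N, TangentSpace I x →L[ℝ] TangentSpace I x →L[ℝ] ℝ}
    (hB : IsSmoothFamily I fun _ => B) : IsSmoothFamily I (RadialMass.warped I (fun r => r) B) where
  symm r hr x v w := congrArg (r ^ 2 * ·) (hB.symm r hr x v w)
  pos r hr x v hv := mul_pos (pow_pos hr 2) (hB.pos r hr x v hv)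
  coord x₀ A C := (contDiff_fst.pow 2).contDiffOn.mul (hB.coord x₀ A C)

variable {B : ∀ x : N, TangentSpace I x →L[ℝ] TangentSpace I x →L[ℝ] ℝ}

theorem radialMass_eq (hB : IsSmoothFamily I fun _ => B) (hG : IsSmoothFamily I G) {r : ℝ}
    (hr : 0 < r) (x : N) :
    radialMass I (fun r => r) B G r x = d * r - r ^ 2 * (shape I G r x).trace := by
  rw [radialMass, hG.meanCurvature_eq hr, hB.warped.meanCurvature_eq hr,
    hB.warped.shape_of_conical (fun _ _ => rfl) hr]
  simp
  field_simp

/-- Differentiate d r - r² tr S with the Riccati equation; the terms without curvature, d - 2r tr S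
+ r² tr S², form the square r² tr (S - r⁻¹ id)². -/
theorem hasDerivAt_radialMass (hB : IsSmoothFamily I fun _ => B) (hG : IsSmoothFamily I G) {r : ℝ}
    (hr : 0 < r) (x : N) :
    HasDerivAt (fun t => radialMass I (fun r => r) B G t x)
      (r ^ 2 * radialRicci I G r x + r ^ 2 * defect I G r x) r := by
  have h := ((hasDerivAt_id r).const_mul (d : ℝ)).sub
    ((hasDerivAt_pow 2 r).mul (hG.hasDerivAt_trace_shape hr x))
  have h' := h.congr_of_eventuallyEq (f₁ := fun t => radialMass I (fun r => r) B G t x) (by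
    filter_upwards [Ioi_mem_nhds hr] with t ht
    rw [hB.radialMass_eq hG ht]
    rfl)
  refine h'.congr_deriv ?_
  rw [defect_expand]
  field_simp
  push_cast
  ring

theorem continuousOn_radialMass (hB : IsSmoothFamily I fun _ => B) (hG : IsSmoothFamily I G) :
    ContinuousOn (fun p : ℝ × N => radialMass I (fun r => r) B G p.1 p.2) (Ioi 0 ×ˢ univ) :=
  (continuousOn_fst.pow 2).mul
    (hB.warped.continuousOn_meanCurvature.sub hG.continuousOn_meanCurvature)

/-- The function is the r-derivative of the radial mass, which is smooth along rays; this avoids a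
separate treatment of `radialRicci`. -/
theorem continuousOn_deriv_radialMass (hB : IsSmoothFamily I fun _ => B)
    (hG : IsSmoothFamily I G) (x : N) :
    ContinuousOn (fun t => t ^ 2 * radialRicci I G t x + t ^ 2 * defect I G t x) (Ioi 0) := by
  have hs : ContDiffOn ℝ ∞ (fun t => radialMass I (fun r => r) B G t x) (Ioi 0) := by
    have h1 : ContDiffOn ℝ ∞ (fun t => d * t - t ^ 2 * (shape I G t x).trace) (Ioi 0) :=
      (contDiffOn_const.mul contDiffOn_id).sub ((contDiffOn_id.pow 2).mul
        (ContDiffOn.sum fun A _ => hG.contDiffOn_shape x A A))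
    exact h1.congr fun t ht => hB.radialMass_eq hG ht x
  refine (hs.continuousOn_deriv_of_isOpen isOpen_Ioi (by simp)).congr fun t ht => ?_
  exact (hB.hasDerivAt_radialMass hG ht x).deriv.symm

theorem radialMass_sub (hB : IsSmoothFamily I fun _ => B) (hG : IsSmoothFamily I G) {a b : ℝ}
    (ha : 0 < a) (hab : a ≤ b) (x : N) :
    ∫ t in Ioc a b, (t ^ 2 * radialRicci I G t x + t ^ 2 * defect I G t x) =
      radialMass I (fun r => r) B G b x - radialMass I (fun r => r) B G a x := by
  rw [← intervalIntegral.integral_of_le hab]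
  have hsub : uIcc a b ⊆ Ioi 0 := by
    rw [uIcc_of_le hab]
    exact fun t ht => ha.trans_le ht.1
  exact intervalIntegral.integral_eq_sub_of_hasDerivAt
    (fun t ht => hB.hasDerivAt_radialMass hG (hsub ht) x)
    ((hB.continuousOn_deriv_radialMass hG x).mono hsub).intervalIntegrable

end IsSmoothFamily

end SmoothFamilies

/-! ### The Riemannian measure is finite and charges open sets -/

section VolumeMeasure

variable {d : ℕ} {H : Type*} [TopologicalSpace H]
  {I : ModelWithCorners ℝ (EuclideanSpace ℝ (Fin d)) H}
  {N : Type*} [TopologicalSpace N] [ChartedSpace H N] [IsManifold I ∞ N]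
  {B : ∀ x : N, TangentSpace I x →L[ℝ] TangentSpace I x →L[ℝ] ℝ}

omit [IsManifold I ∞ N] in
theorem IsSmoothFamily.continuousOn_coordMatrix (hB : IsSmoothFamily I fun _ => B) (x₀ : N) :
    ContinuousOn (coordMatrix I x₀ B) (extChartAt I x₀).target :=
  continuousOn_pi.2 fun A => continuousOn_pi.2 fun C =>
    (hB.coord x₀ A C).continuousOn.comp (f := fun y => ((1 : ℝ), y))
      (continuousOn_const.prodMk continuousOn_id) fun _ hy => ⟨mem_Ioi.2 one_pos, hy⟩

theorem IsSmoothFamily.det_coordMatrix_pos (hB : IsSmoothFamily I fun _ => B) (x₀ : N)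
    {y : EuclideanSpace ℝ (Fin d)} (hy : y ∈ (extChartAt I x₀).target) :
    0 < (coordMatrix I x₀ B y).det := by
  rw [coordMatrix_eq_congr, Matrix.det_mul, Matrix.det_mul, Matrix.det_transpose]
  have hF := ((Matrix.isUnit_iff_isUnit_det _).1 (isUnit_frameMatrix I x₀ hy)).ne_zero
  have hS := (hB.posDef one_pos ((extChartAt I x₀).symm y)).det_pos
  nlinarith [mul_pos (pow_pos (abs_pos.2 hF) 2) hS, sq_abs (frameMatrix I x₀ y).det]

omit [IsManifold I ∞ N] in
theorem measurableSet_extChartAt_target (x₀ : N) :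
    MeasurableSet (extChartAt I x₀).target := by
  rw [extChartAt_target]
  exact ((chartAt H x₀).open_target.preimage I.continuous_symm).measurableSet.inter
    I.isClosed_range.measurableSet

variable [CompactSpace N] [T2Space N]

/-- The density of the Riemannian measure in the chart at `x₀`. -/
def chartDensity (I : ModelWithCorners ℝ (EuclideanSpace ℝ (Fin d)) H)
    (B : ∀ x : N, TangentSpace I x →L[ℝ] TangentSpace I x →L[ℝ] ℝ) (x₀ : N)
    (y : EuclideanSpace ℝ (Fin d)) : ℝ :=
  chartPartition I x₀ ((extChartAt I x₀).symm y) * √((coordMatrix I x₀ B y).det)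

omit [IsManifold I ∞ N] in
theorem IsSmoothFamily.continuousOn_chartDensity (hB : IsSmoothFamily I fun _ => B) (x₀ : N) :
    ContinuousOn (chartDensity I B x₀) (extChartAt I x₀).target :=
  ((chartPartition I x₀).continuous.comp_continuousOn (continuousOn_extChartAt_symm x₀)).mul
    ((continuous_id.matrix_det.comp_continuousOn (hB.continuousOn_coordMatrix x₀)).sqrt)

omit [IsManifold I ∞ N] in
theorem IsSmoothFamily.aemeasurable_chartDensity (hB : IsSmoothFamily I fun _ => B) (x₀ : N) :
    AEMeasurable (fun y => ENNReal.ofReal (chartDensity I B x₀ y))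
      (volume.restrict (extChartAt I x₀).target) :=
  ((hB.continuousOn_chartDensity x₀).aemeasurable (measurableSet_extChartAt_target x₀)).ennreal_ofReal

-- The density is continuous, hence bounded, on the compact image of the support of the partition
-- function, and zero off it.
omit [IsManifold I ∞ N] in
theorem IsSmoothFamily.lintegral_chartDensity_lt_top (hB : IsSmoothFamily I fun _ => B) (x₀ : N) :
    ∫⁻ y in (extChartAt I x₀).target, ENNReal.ofReal (chartDensity I B x₀ y) < ⊤ := by
  set K : Set (EuclideanSpace ℝ (Fin d)) := extChartAt I x₀ '' tsupport (chartPartition I x₀)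
  have hsub : tsupport (chartPartition I x₀) ⊆ (extChartAt I x₀).source :=
    (exists_chartPartition I).choose_spec x₀
  have hK : IsCompact K :=
    (isClosed_tsupport _).isCompact.image_of_continuousOn ((continuousOn_extChartAt x₀).mono hsub)
  have hKt : K ⊆ (extChartAt I x₀).target := by
    rintro _ ⟨x, hx, rfl⟩
    exact (extChartAt I x₀).map_source (hsub hx)
  obtain ⟨C, hC⟩ := hK.exists_bound_of_continuousOn ((hB.continuousOn_chartDensity x₀).mono hKt)
  calc ∫⁻ y in (extChartAt I x₀).target, ENNReal.ofReal (chartDensity I B x₀ y)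
      ≤ ∫⁻ y in (extChartAt I x₀).target, K.indicator (fun _ => ENNReal.ofReal C) y := by
        refine setLIntegral_mono' (measurableSet_extChartAt_target x₀) fun y hy => ?_
        by_cases hyK : y ∈ K
        · rw [indicator_of_mem hyK]
          exact ENNReal.ofReal_le_ofReal ((le_abs_self _).trans (hC y hyK))
        · have : (extChartAt I x₀).symm y ∉ tsupport (chartPartition I x₀) := fun h =>
            hyK ⟨_, h, (extChartAt I x₀).right_inv hy⟩
          rw [chartDensity, image_eq_zero_of_notMem_tsupport this]
          simp
    _ ≤ ∫⁻ y, K.indicator (fun _ => ENNReal.ofReal C) y := lintegral_mono' Measure.restrict_le_self le_rfl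
    _ = ENNReal.ofReal C * volume K := lintegral_indicator_const hK.measurableSet _
    _ < ⊤ := ENNReal.mul_lt_top ENNReal.ofReal_lt_top hK.measure_lt_top

variable [MeasurableSpace N] [BorelSpace N]

omit [IsManifold I ∞ N] in
theorem aemeasurable_extChartAt_symm (x₀ : N) :
    AEMeasurable (extChartAt I x₀).symm ((volume.restrict
      (extChartAt I x₀).target).withDensity fun y => ENNReal.ofReal (chartDensity I B x₀ y)) :=
  ((continuousOn_extChartAt_symm x₀).aemeasurable (measurableSet_extChartAt_target x₀)).mono_ac
    (withDensity_absolutelyContinuous _ _)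

omit [IsManifold I ∞ N] in
theorem map_chartDensity_univ (x₀ : N) :
    Measure.map (extChartAt I x₀).symm ((volume.restrict
      (extChartAt I x₀).target).withDensity fun y => ENNReal.ofReal (chartDensity I B x₀ y)) univ =
    ∫⁻ y in (extChartAt I x₀).target, ENNReal.ofReal (chartDensity I B x₀ y) := by
  rw [Measure.map_apply_of_aemeasurable (aemeasurable_extChartAt_symm x₀) MeasurableSet.univ,
    preimage_univ, withDensity_apply _ MeasurableSet.univ, Measure.restrict_univ]

-- By local finiteness and compactness only finitely many partition functions are nonzero.
omit [IsManifold I ∞ N] in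
theorem IsSmoothFamily.isFiniteMeasure_volumeMeasure (hB : IsSmoothFamily I fun _ => B) :
    IsFiniteMeasure (volumeMeasure I B) := by
  have hfin : {x₀ : N | (Function.support (chartPartition I x₀)).Nonempty}.Finite :=
    (chartPartition I).locallyFinite.finite_nonempty_of_compact
  refine ⟨?_⟩
  rw [volumeMeasure, Measure.sum_apply _ MeasurableSet.univ, tsum_eq_sum (s := hfin.toFinset)]
  · exact ENNReal.sum_lt_top.2 fun x₀ _ =>
      (map_chartDensity_univ x₀).trans_lt (hB.lintegral_chartDensity_lt_top x₀)
  · intro x₀ hx₀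
    refine (map_chartDensity_univ x₀).trans ?_
    have h0 : ⇑(chartPartition I x₀) = 0 := by
      simpa [not_nonempty_iff_eq_empty] using hx₀
    have h1 : ∀ z, chartPartition I x₀ z = 0 := fun z => congrFun h0 z
    simp only [chartDensity, h1]
    simp

/-- Some partition function is positive at x, so the density in its chart is positive near x, and
one summand already gives `U` positive mass. -/
theorem IsSmoothFamily.isOpenPosMeasure_volumeMeasure (hB : IsSmoothFamily I fun _ => B) :
    (volumeMeasure I B).IsOpenPosMeasure := by
  refine ⟨fun U hU ⟨x, hx⟩ h0 => ?_⟩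
  obtain ⟨x₀, hx₀⟩ := (chartPartition I).exists_pos (mem_univ x)
  have hsub : tsupport (chartPartition I x₀) ⊆ (extChartAt I x₀).source :=
    (exists_chartPartition I).choose_spec x₀
  have hxs : x ∈ (extChartAt I x₀).source := hsub (subset_tsupport _ hx₀.ne')
  have h1 := le_antisymm ((Measure.le_sum _ x₀ U).trans_eq h0) bot_le
  have h2 : ((volume.restrict (extChartAt I x₀).target).withDensity fun y =>
      ENNReal.ofReal (chartDensity I B x₀ y)) ((extChartAt I x₀).symm ⁻¹' U) = 0 := by
    rw [← Measure.map_apply_of_aemeasurable (aemeasurable_extChartAt_symm x₀) hU.measurableSet]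
    exact h1
  rw [withDensity_apply_eq_zero' (hB.aemeasurable_chartDensity x₀)] at h2
  have h3 := le_antisymm ((Measure.le_restrict_apply _ _).trans_eq h2) bot_le
  have hW : {y | ENNReal.ofReal (chartDensity I B x₀ y) ≠ 0} ∩ (extChartAt I x₀).symm ⁻¹' U ∩
      (extChartAt I x₀).target ∈ 𝓝[range I] (extChartAt I x₀ x) := by
    have hc := (continuousAt_extChartAt_symm' hxs).continuousWithinAt (s := range I)
    have hU' : U ∩ {z | 0 < chartPartition I x₀ z} ∈
        𝓝 ((extChartAt I x₀).symm (extChartAt I x₀ x)) := by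
      rw [(extChartAt I x₀).left_inv hxs]
      exact (hU.inter (isOpen_lt continuous_const (chartPartition I x₀).continuous)).mem_nhds
        ⟨hx, hx₀⟩
    filter_upwards [hc hU', extChartAt_target_mem_nhdsWithin' hxs] with y hy hyt
    refine ⟨⟨?_, hy.1⟩, hyt⟩
    exact (ENNReal.ofReal_pos.2 (mul_pos hy.2
      (Real.sqrt_pos.2 (hB.det_coordMatrix_pos x₀ hyt)))).ne'
  obtain ⟨V, hV, hxV, hVW⟩ := mem_nhdsWithin.1 hW
  -- At a boundary point the chart image is only a neighbourhood within `range I`; it still contains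
  -- a nonempty Euclidean open set, because `range I` lies in the closure of its interior.
  have hxr : extChartAt I x₀ x ∈ closure (interior (range I)) :=
    I.range_subset_closure_interior
      (extChartAt_target_subset_range x₀ ((extChartAt I x₀).map_source hxs))
  have hne := mem_closure_iff.1 hxr V hV hxV
  refine ((hV.inter isOpen_interior).measure_pos volume hne).ne' (measure_mono_null ?_ h3)
  exact fun y hy => hVW ⟨hy.1, interior_subset hy.2⟩

end VolumeMeasure

/-! ### Integration over (0, ∞) × N and the mass inequality -/

section MassFormula

/-- An exhaustion of `(0, ∞)` by bounded intervals. -/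
def exhaust (k : ℕ) : Set ℝ := Ioc ((k + 1 : ℝ)⁻¹) (k + 1)

theorem exhaust_left_pos (k : ℕ) : (0 : ℝ) < (k + 1 : ℝ)⁻¹ := by positivity

theorem exhaust_left_le (k : ℕ) : ((k + 1 : ℝ)⁻¹) ≤ k + 1 := by
  have h : (1 : ℝ) ≤ k + 1 := by simp
  exact (inv_le_one_of_one_le₀ h).trans h

theorem monotone_exhaust : Monotone exhaust := by
  intro j k hjk
  have h : (j : ℝ) + 1 ≤ k + 1 := by gcongr
  exact Ioc_subset_Ioc (inv_anti₀ (by positivity) h) h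

theorem iUnion_exhaust : ⋃ k, exhaust k = Ioi 0 := by
  ext t
  simp only [mem_iUnion, mem_Ioi]
  refine ⟨fun ⟨k, hk⟩ => (exhaust_left_pos k).trans hk.1, fun ht => ?_⟩
  obtain ⟨j, hj⟩ := exists_nat_gt (max t t⁻¹)
  have h1 : t⁻¹ < j + 1 := ((le_max_right _ _).trans_lt hj).trans (by simp)
  refine ⟨j, ?_, ((le_max_left _ _).trans hj.le).trans (by simp)⟩
  exact inv_lt_of_inv_lt₀ ht h1

variable {d : ℕ} {H : Type*} [TopologicalSpace H]
  {I : ModelWithCorners ℝ (EuclideanSpace ℝ (Fin d)) H}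
  {N : Type*} [TopologicalSpace N] [ChartedSpace H N] [IsManifold I ∞ N]
  {B : ∀ x : N, TangentSpace I x →L[ℝ] TangentSpace I x →L[ℝ] ℝ}
  {G : ℝ → ∀ x : N, TangentSpace I x →L[ℝ] TangentSpace I x →L[ℝ] ℝ}
  [CompactSpace N] [T2Space N] [MeasurableSpace N] [BorelSpace N]

namespace IsSmoothFamily

theorem integrable_radialMass (hB : IsSmoothFamily I fun _ => B) (hG : IsSmoothFamily I G) {r : ℝ}
    (hr : 0 < r) : Integrable (radialMass I (fun r => r) B G r) (volumeMeasure I B) := by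
  have := hB.isFiniteMeasure_volumeMeasure
  have hc : ContinuousOn (radialMass I (fun r => r) B G r) univ :=
    (hB.continuousOn_radialMass hG).comp (f := fun x => (r, x))
      (Continuous.prodMk_right r).continuousOn fun x _ => ⟨hr, mem_univ x⟩
  rw [← integrableOn_univ]
  exact hc.integrableOn_compact isCompact_univ

theorem integrableOn_defect (hB : IsSmoothFamily I fun _ => B) (hG : IsSmoothFamily I G) {a b : ℝ}
    (ha : 0 < a) : IntegrableOn (fun p : ℝ × N => p.1 ^ 2 * defect I G p.1 p.2) (Ioc a b ×ˢ univ)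
      ((volume.restrict (Ioi 0)).prod (volumeMeasure I B)) := by
  have := hB.isFiniteMeasure_volumeMeasure
  have hc : ContinuousOn (fun p : ℝ × N => p.1 ^ 2 * defect I G p.1 p.2) (Icc a b ×ˢ univ) :=
    ((continuousOn_fst.pow 2).mul hG.continuousOn_defect).mono
      (prod_mono_left fun t ht => ha.trans_le ht.1)
  exact (hc.integrableOn_compact (isCompact_Icc.prod isCompact_univ)).mono_set
    (prod_mono_left Ioc_subset_Icc_self)

theorem totalRadialMass_sub (hB : IsSmoothFamily I fun _ => B) (hG : IsSmoothFamily I G)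
    (hR : Integrable (fun p : ℝ × N => p.1 ^ 2 * radialRicci I G p.1 p.2)
      ((volume.restrict (Ioi 0)).prod (volumeMeasure I B))) {a b : ℝ} (ha : 0 < a) (hab : a ≤ b) :
    (∫ p in Ioc a b ×ˢ univ, p.1 ^ 2 * radialRicci I G p.1 p.2
        ∂((volume.restrict (Ioi 0)).prod (volumeMeasure I B))) +
      ∫ p in Ioc a b ×ˢ univ, p.1 ^ 2 * defect I G p.1 p.2
        ∂((volume.restrict (Ioi 0)).prod (volumeMeasure I B)) =
    totalRadialMass I (fun r => r) B G b - totalRadialMass I (fun r => r) B G a := by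
  have := hB.isFiniteMeasure_volumeMeasure
  have hq := hB.integrableOn_defect hG (b := b) ha
  have hsum : IntegrableOn (fun p : ℝ × N => p.1 ^ 2 * radialRicci I G p.1 p.2 +
      p.1 ^ 2 * defect I G p.1 p.2) (Ioc a b ×ˢ univ)
      ((volume.restrict (Ioi 0)).prod (volumeMeasure I B)) := hR.integrableOn.add hq
  rw [← integral_add hR.integrableOn hq]
  have hν : ((volume.restrict (Ioi (0 : ℝ))).prod (volumeMeasure I B)).restrict (Ioc a b ×ˢ univ) =
      (volume.restrict (Ioc a b)).prod (volumeMeasure I B) := by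
    rw [← Measure.prod_restrict, Measure.restrict_univ, Measure.restrict_restrict measurableSet_Ioc,
      inter_eq_left.2 fun t ht => mem_Ioi.2 (ha.trans ht.1)]
  rw [IntegrableOn, hν] at hsum
  -- Fubini with r as the inner variable, so that the fundamental theorem of calculus applies on
  -- each ray.
  rw [hν, integral_prod_symm _ hsum, totalRadialMass, totalRadialMass,
    ← integral_sub (hB.integrable_radialMass hG (ha.trans_le hab)) (hB.integrable_radialMass hG ha)]
  exact integral_congr_ae (.of_forall fun x => hB.radialMass_sub hG ha hab x)

variable {M₀ Minf : ℝ}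

/-- Global integrability of the defect is not presupposed: its integrals over the pieces converge
because the masses and the Ricci integrals do. -/
theorem tendsto_integral_defect (hB : IsSmoothFamily I fun _ => B) (hG : IsSmoothFamily I G)
    (hM₀ : Tendsto (totalRadialMass I (fun r => r) B G) (𝓝[>] 0) (𝓝 M₀))
    (hMinf : Tendsto (totalRadialMass I (fun r => r) B G) atTop (𝓝 Minf))
    (hR : Integrable (fun p : ℝ × N => p.1 ^ 2 * radialRicci I G p.1 p.2)
      ((volume.restrict (Ioi 0)).prod (volumeMeasure I B))) :
    Tendsto (fun k => ∫ p in exhaust k ×ˢ univ, p.1 ^ 2 * defect I G p.1 p.2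
        ∂((volume.restrict (Ioi 0)).prod (volumeMeasure I B))) atTop
      (𝓝 (Minf - M₀ - ∫ p, p.1 ^ 2 * radialRicci I G p.1 p.2
        ∂((volume.restrict (Ioi 0)).prod (volumeMeasure I B)))) := by
  have := hB.isFiniteMeasure_volumeMeasure
  have hr : Tendsto (fun k : ℕ => (k + 1 : ℝ)) atTop atTop :=
    tendsto_atTop_add_const_right _ _ tendsto_natCast_atTop_atTop
  have hl : Tendsto (fun k : ℕ => (k + 1 : ℝ)⁻¹) atTop (𝓝[>] 0) :=
    tendsto_inv_atTop_nhdsGT_zero.comp hr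
  have hU : ⋃ k, exhaust k ×ˢ (univ : Set N) = Ioi 0 ×ˢ univ := by
    rw [← iUnion_prod_const, iUnion_exhaust]
  have hf := tendsto_setIntegral_of_monotone (s := fun k => exhaust k ×ˢ (univ : Set N))
    (fun k => measurableSet_Ioc.prod MeasurableSet.univ)
    (fun j k hjk => prod_mono_left (monotone_exhaust hjk)) (hR.integrableOn)
  have hν : ((volume.restrict (Ioi (0 : ℝ))).prod (volumeMeasure I B)).restrict (Ioi 0 ×ˢ univ) =
      (volume.restrict (Ioi 0)).prod (volumeMeasure I B) := by
    rw [← Measure.prod_restrict, Measure.restrict_univ, Measure.restrict_restrict measurableSet_Ioi,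
      inter_self]
  rw [hU, hν] at hf
  refine (((hMinf.comp hr).sub (hM₀.comp hl)).sub hf).congr fun k => ?_
  have h := hB.totalRadialMass_sub hG hR (exhaust_left_pos k) (exhaust_left_le k)
  simp only [Function.comp_apply, exhaust]
  linarith

theorem setIntegral_defect_le (hB : IsSmoothFamily I fun _ => B) (hG : IsSmoothFamily I G)
    {j k : ℕ} (hjk : j ≤ k) :
    ∫ p in exhaust j ×ˢ univ, p.1 ^ 2 * defect I G p.1 p.2
        ∂((volume.restrict (Ioi 0)).prod (volumeMeasure I B)) ≤
      ∫ p in exhaust k ×ˢ univ, p.1 ^ 2 * defect I G p.1 p.2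
        ∂((volume.restrict (Ioi 0)).prod (volumeMeasure I B)) := by
  refine setIntegral_mono_set (hB.integrableOn_defect hG (exhaust_left_pos k)) ?_
    (.of_forall (prod_mono_left (monotone_exhaust hjk)))
  filter_upwards [ae_restrict_mem (measurableSet_Ioc.prod MeasurableSet.univ)] with p hp
  exact mul_nonneg (sq_nonneg _) (hG.defect_nonneg ((exhaust_left_pos k).trans hp.1.1) p.2)

omit [IsManifold I ∞ N] [BorelSpace N] in
theorem setIntegral_defect_nonneg (hG : IsSmoothFamily I G) (k : ℕ) :
    0 ≤ ∫ p in exhaust k ×ˢ univ, p.1 ^ 2 * defect I G p.1 p.2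
        ∂((volume.restrict (Ioi 0)).prod (volumeMeasure I B)) :=
  setIntegral_nonneg (measurableSet_Ioc.prod MeasurableSet.univ) fun p hp =>
    mul_nonneg (sq_nonneg _) (hG.defect_nonneg ((exhaust_left_pos k).trans hp.1.1) p.2)

/-- A nonnegative function with zero integral vanishes almost everywhere on each piece; continuity
and positivity of the product measure on open sets make this hold everywhere. -/
theorem defect_eq_zero_of_setIntegral (hB : IsSmoothFamily I fun _ => B) (hG : IsSmoothFamily I G)
    (h0 : ∀ k, ∫ p in exhaust k ×ˢ univ, p.1 ^ 2 * defect I G p.1 p.2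
        ∂((volume.restrict (Ioi 0)).prod (volumeMeasure I B)) = 0)
    {r : ℝ} (hr : 0 < r) (x : N) : defect I G r x = 0 := by
  have := hB.isFiniteMeasure_volumeMeasure
  have := hB.isOpenPosMeasure_volumeMeasure
  have hU : ⋃ k, exhaust k ×ˢ (univ : Set N) = Ioi 0 ×ˢ univ := by
    rw [← iUnion_prod_const, iUnion_exhaust]
  have hν : ((volume.restrict (Ioi (0 : ℝ))).prod (volumeMeasure I B)).restrict (Ioi 0 ×ˢ univ) =
      ((volume : Measure ℝ).prod (volumeMeasure I B)).restrict (Ioi 0 ×ˢ univ) := by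
    rw [← Measure.prod_restrict, Measure.restrict_restrict measurableSet_Ioi, inter_self,
      Measure.prod_restrict]
  have hae : (fun p : ℝ × N => p.1 ^ 2 * defect I G p.1 p.2) =ᵐ[((volume : Measure ℝ).prod
      (volumeMeasure I B)).restrict (Ioi 0 ×ˢ univ)] fun _ => 0 := by
    rw [← hν, ← hU]
    refine (ae_restrict_iUnion_iff _ _).2 fun k => ?_
    refine (setIntegral_eq_zero_iff_of_nonneg_ae ?_
      (hB.integrableOn_defect hG (exhaust_left_pos k))).1 (h0 k)
    filter_upwards [ae_restrict_mem (measurableSet_Ioc.prod MeasurableSet.univ)] with p hp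
    exact mul_nonneg (sq_nonneg _) (hG.defect_nonneg ((exhaust_left_pos k).trans hp.1.1) p.2)
  have h := Measure.eqOn_open_of_ae_eq hae (isOpen_Ioi.prod isOpen_univ)
    ((continuousOn_fst.pow 2).mul hG.continuousOn_defect) continuousOn_const
    (show (r, x) ∈ Ioi (0 : ℝ) ×ˢ univ from ⟨hr, mem_univ x⟩)
  exact (mul_eq_zero.1 h).resolve_left (pow_ne_zero 2 hr.ne')

/-- The mass inequality, with equality exactly for cones. -/
theorem mass_inequality (hB : IsSmoothFamily I fun _ => B) (hG : IsSmoothFamily I G)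
    (hM₀ : Tendsto (totalRadialMass I (fun r => r) B G) (𝓝[>] 0) (𝓝 M₀))
    (hMinf : Tendsto (totalRadialMass I (fun r => r) B G) atTop (𝓝 Minf))
    (hR : Integrable (fun p : ℝ × N => p.1 ^ 2 * radialRicci I G p.1 p.2)
      ((volume.restrict (Ioi 0)).prod (volumeMeasure I B))) :
    (∫ p, p.1 ^ 2 * radialRicci I G p.1 p.2
        ∂((volume.restrict (Ioi 0)).prod (volumeMeasure I B)) ≤ Minf - M₀) ∧
    (Minf - M₀ = ∫ p, p.1 ^ 2 * radialRicci I G p.1 p.2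
        ∂((volume.restrict (Ioi 0)).prod (volumeMeasure I B)) ↔
      ∀ r > 0, ∀ x, G r x = r ^ 2 • G 1 x) := by
  have hlim := hB.tendsto_integral_defect hG hM₀ hMinf hR
  refine ⟨sub_nonneg.1 (ge_of_tendsto' hlim fun k => hG.setIntegral_defect_nonneg k),
    fun heq r hr x => ?_, fun hcone => ?_⟩
  -- The integrals over the exhaustion are nonnegative, increase with k and tend to 0, so each one
  -- is 0.
  · rw [heq, sub_self] at hlim
    refine hG.eq_sq_smul_of_defect (fun t ht => hB.defect_eq_zero_of_setIntegral hG (fun k => ?_)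
      ht x) hr
    refine le_antisymm (ge_of_tendsto hlim ?_) (hG.setIntegral_defect_nonneg k)
    filter_upwards [eventually_ge_atTop k] with j hj using hB.setIntegral_defect_le hG hj
  · have h0 : ∀ k, ∫ p in exhaust k ×ˢ univ, p.1 ^ 2 * defect I G p.1 p.2
        ∂((volume.restrict (Ioi 0)).prod (volumeMeasure I B)) = 0 := fun k => by
      refine setIntegral_eq_zero_of_forall_eq_zero fun p hp => ?_
      have hp0 := (exhaust_left_pos k).trans hp.1.1
      rw [defect, hG.shape_of_conical (fun t ht => hcone t ht p.2) hp0]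
      simp
    simp only [h0] at hlim
    exact sub_eq_zero.1 (tendsto_nhds_unique hlim tendsto_const_nhds)

end IsSmoothFamily

end MassFormula

/-! ### Rigidity under the asymptotic condition -/

section Asymptotics

/-- Needed for uniqueness of limits. A finite r₀, including 0, is approached from the right. -/
theorem radialFilter_neBot {r₀ : EReal} (h : r₀ ∈ Icc (0 : EReal) ⊤) : (radialFilter r₀).NeBot := by
  induction r₀ with
  | bot => exact absurd h.1 (by simp)
  | top =>
    refine (atTop_neBot (α := ℝ)).mono (le_inf ?_ ?_)
    · exact tendsto_iff_comap.1 EReal.tendsto_coe_atTop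
    · exact le_principal_iff.2 (Ioi_mem_atTop 0)
  | coe a =>
    have ha : 0 ≤ a := EReal.coe_nonneg.1 h.1
    refine (inferInstance : (𝓝[>] a).NeBot).mono (le_inf ?_ ?_)
    · exact nhdsWithin_le_nhds.trans (tendsto_iff_comap.1 continuous_coe_real_ereal.continuousAt)
    · exact le_principal_iff.2 (mem_of_superset self_mem_nhdsWithin fun t ht => ha.trans_lt ht)

variable {d : ℕ} {H : Type*} [TopologicalSpace H]
  {I : ModelWithCorners ℝ (EuclideanSpace ℝ (Fin d)) H}
  {N : Type*} [TopologicalSpace N] [ChartedSpace H N] [IsManifold I ∞ N]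
  {B : ∀ x : N, TangentSpace I x →L[ℝ] TangentSpace I x →L[ℝ] ℝ}
  {G : ℝ → ∀ x : N, TangentSpace I x →L[ℝ] TangentSpace I x →L[ℝ] ℝ}

theorem tensorNorm_eq {A T : ∀ x : N, TangentSpace I x →L[ℝ] TangentSpace I x →L[ℝ] ℝ} {x : N}
    (hA : (stdMatrix (d := d) (A x)).IsSymm) (hT : (stdMatrix (d := d) (T x)).IsSymm) :
    tensorNorm I A T x = √((stdMatrix (d := d) (A x))⁻¹ * stdMatrix (d := d) (T x) *
      ((stdMatrix (d := d) (A x))⁻¹ * stdMatrix (d := d) (T x))).trace := by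
  rw [tensorNorm]
  simp only [coordMatrix_self]
  congr 1
  have hA' : (stdMatrix (d := d) (A x))⁻¹.IsSymm := by
    rw [Matrix.IsSymm, Matrix.transpose_nonsing_inv, hA.eq]
  generalize (stdMatrix (d := d) (A x))⁻¹ = β at hA'
  generalize stdMatrix (d := d) (T x) = τ at hT
  simp only [Matrix.trace, Matrix.diag, Matrix.mul_apply, Finset.sum_mul_sum]
  symm
  calc ∑ D, ∑ C, ∑ E, ∑ A, β D E * τ E C * (β C A * τ A D)
      = ∑ D, ∑ A, ∑ C, ∑ E, β D E * τ E C * (β C A * τ A D) := Finset.sum_congr rfl fun D _ =>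
        (Finset.sum_congr rfl fun C _ => Finset.sum_comm).trans Finset.sum_comm
    _ = ∑ A, ∑ C, ∑ D, ∑ E, β D E * τ E C * (β C A * τ A D) :=
        Finset.sum_comm.trans (Finset.sum_congr rfl fun A _ => Finset.sum_comm)
    _ = ∑ A, ∑ C, ∑ D, ∑ E, β A C * β D E * τ A D * τ C E := by
        refine Finset.sum_congr rfl fun A _ => Finset.sum_congr rfl fun C _ =>
          Finset.sum_congr rfl fun D _ => Finset.sum_congr rfl fun E _ => ?_
        rw [hA'.apply A C, hT.apply C E]
        ring

/-- On a cone the factors r² of G - G₀ and r⁻² of G₀⁻¹ cancel, so the norm is constant in r. Tending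
to 0, it is 0, and definiteness of the norm concludes. -/
theorem eq_of_isAsymptoticAt (hB : IsSmoothFamily I fun _ => B) (hG : IsSmoothFamily I G)
    {r₀ : EReal} (hr₀ : r₀ ∈ Icc (0 : EReal) ⊤) (hasym : IsAsymptoticAt I (fun r => r) B G r₀)
    (hcone : ∀ r > 0, ∀ x, G r x = r ^ 2 • G 1 x) (x : N) : G 1 x = B x := by
  have := radialFilter_neBot hr₀
  set K : Matrix (Fin d) (Fin d) ℝ := stdMatrix (B x)
  set T : Matrix (Fin d) (Fin d) ℝ := stdMatrix (G 1 x) - K with hT_def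
  have hK : K.PosDef := hB.posDef one_pos x
  have hKs : K.IsSymm := hB.isSymm_stdMatrix one_pos x
  have hTs : T.IsSymm := (hG.isSymm_stdMatrix one_pos x).sub hKs
  have hval : ∀ r > 0, tensorNorm I (warped I (fun r => r) B r)
      (fun z => G r z - warped I (fun r => r) B r z) x = √(K⁻¹ * T * (K⁻¹ * T)).trace := by
    intro r hr
    have h1 : stdMatrix (d := d) (warped I (fun r => r) B r x) = r ^ 2 • K := rfl
    have h2 : stdMatrix (d := d) (G r x - warped I (fun r => r) B r x) = r ^ 2 • T := by
      rw [hcone r hr, hT_def, smul_sub]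
      rfl
    have hr2 : r ^ 2 ≠ 0 := by positivity
    have h3 : (r ^ 2 • K)⁻¹ = (r ^ 2)⁻¹ • K⁻¹ := Matrix.inv_eq_right_inv <| by
      rw [Matrix.smul_mul, Matrix.mul_smul, smul_smul, mul_inv_cancel₀ hr2, one_smul,
        Matrix.mul_nonsing_inv _ ((Matrix.isUnit_iff_isUnit_det _).1 hK.isUnit)]
    have h4 : (r ^ 2)⁻¹ • K⁻¹ * r ^ 2 • T = K⁻¹ * T := by
      rw [Matrix.smul_mul, Matrix.mul_smul, smul_smul, inv_mul_cancel₀ hr2, one_smul]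
    rw [tensorNorm_eq (by rw [h1]; exact hKs.smul _) (by rw [h2]; exact hTs.smul _), h1, h2, h3, h4]
  have hlim := hasym.tendsto_at x
  have hev : ∀ᶠ r in radialFilter r₀, r ∈ Ioi (0 : ℝ) := mem_inf_of_right (mem_principal_self _)
  have h0 : √(K⁻¹ * T * (K⁻¹ * T)).trace = 0 := by
    refine tendsto_nhds_unique (Tendsto.congr' ?_ tendsto_const_nhds) hlim
    filter_upwards [hev] with r hr using (hval r hr).symm
  have h1 := (Real.sqrt_eq_zero (trace_sq_nonneg hK hTs)).1 h0
  exact stdMatrix_injective (d := d) (sub_eq_zero.1 (eq_zero_of_trace_sq hK hTs h1))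

/-- By compactness of the unit sphere, B(v, v) ≥ c‖v‖² for some c > 0. This supplies the boundedness
field of a Riemannian metric. -/
theorem isVonNBounded_of_pos {B : EuclideanSpace ℝ (Fin d) →L[ℝ] EuclideanSpace ℝ (Fin d) →L[ℝ] ℝ}
    (hp : ∀ v, v ≠ 0 → 0 < B v v) : Bornology.IsVonNBounded ℝ {v | B v v < 1} := by
  have hc : Continuous fun v => B v v := by fun_prop
  obtain ⟨c, hc0, hcle⟩ := (isCompact_sphere (0 : EuclideanSpace ℝ (Fin d)) 1).exists_forall_le'
    hc.continuousOn (a := 0) fun v hv => hp v (by rintro rfl; simp at hv)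
  refine NormedSpace.isVonNBounded_of_isBounded ℝ
    ((Metric.isBounded_closedBall (x := 0) (r := √c⁻¹)).subset fun v hv => ?_)
  rw [mem_closedBall_zero_iff]
  rcases eq_or_ne v 0 with rfl | hv0
  · simp
  have hn : 0 < ‖v‖ := norm_pos_iff.2 hv0
  have h := hcle (‖v‖⁻¹ • v) (by simp [norm_smul, hn.ne'])
  simp only [map_smul, smul_apply, smul_eq_mul] at h
  refine Real.le_sqrt_of_sq_le ?_
  have h2 : c * ‖v‖ ^ 2 ≤ B v v := by
    calc c * ‖v‖ ^ 2 ≤ (‖v‖⁻¹ * (‖v‖⁻¹ * B v v)) * ‖v‖ ^ 2 := by gcongr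
      _ = B v v := by field_simp
  rw [← one_div, le_div_iff₀ hc0]
  have : B v v < 1 := hv
  linarith

/-- The metric `G(r)` as a Riemannian metric on `N`. -/
def IsMetricFamily.metric (hG : IsMetricFamily I G) {r : ℝ} (hr : 0 < r) :
    Bundle.ContMDiffRiemannianMetric I ∞ (EuclideanSpace ℝ (Fin d))
      (fun x : N => TangentSpace I x) where
  inner := G r
  symm := hG.symm r hr
  pos := hG.pos r hr
  isVonNBounded x := isVonNBounded_of_pos (hG.pos r hr x)
  contMDiff := by
    have h : ContMDiff I (𝓘(ℝ, ℝ).prod I) ∞ (fun x : N => (r, x)) :=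
      contMDiff_const.prodMk contMDiff_id
    exact contMDiffOn_univ.1 (hG.smooth.comp h.contMDiffOn fun x _ => ⟨hr, mem_univ x⟩)

theorem isMetricFamily_const (B : Bundle.ContMDiffRiemannianMetric I ∞ (EuclideanSpace ℝ (Fin d))
    (fun x : N => TangentSpace I x)) : IsMetricFamily I fun _ => B.inner where
  symm _ _ := B.symm
  pos _ _ := B.pos
  smooth := (B.contMDiff.comp (contMDiff_snd (I := 𝓘(ℝ, ℝ)))).contMDiffOn

end Asymptotics

end RadialMass

end

/-! ### The main theorem -/

theorem corollary5p2 {n : ℕ} (hn : 2 ≤ n) {H : Type*} [TopologicalSpace H]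
    (I : ModelWithCorners ℝ (EuclideanSpace ℝ (Fin (n - 1))) H)
    {N : Type*} [TopologicalSpace N] [ChartedSpace H N] [IsManifold I ∞ N]
    [CompactSpace N] [T2Space N] [MeasurableSpace N] [BorelSpace N]
    (Ghat : Bundle.ContMDiffRiemannianMetric I ∞ (EuclideanSpace ℝ (Fin (n - 1)))
      (fun x : N => TangentSpace I x))
    (G : ℝ → ∀ x : N, TangentSpace I x →L[ℝ] TangentSpace I x →L[ℝ] ℝ)
    (hG : RadialMass.IsMetricFamily I G)
    (M₀ Minf : ℝ)
    (hM₀ : Tendsto (RadialMass.totalRadialMass I (fun r => r) Ghat.inner G) (𝓝[>] 0) (𝓝 M₀))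
    (hMinf : Tendsto (RadialMass.totalRadialMass I (fun r => r) Ghat.inner G) atTop (𝓝 Minf))
    (hR : Integrable (fun p : ℝ × N => p.1 ^ 2 * RadialMass.radialRicci I G p.1 p.2)
      ((volume.restrict (Ioi 0)).prod (RadialMass.volumeMeasure I Ghat.inner))) :
    (∫ p : ℝ × N, p.1 ^ 2 * RadialMass.radialRicci I G p.1 p.2
        ∂((volume.restrict (Ioi 0)).prod (RadialMass.volumeMeasure I Ghat.inner)) ≤ Minf - M₀) ∧
    (Minf - M₀ = ∫ p : ℝ × N, p.1 ^ 2 * RadialMass.radialRicci I G p.1 p.2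
        ∂((volume.restrict (Ioi 0)).prod (RadialMass.volumeMeasure I Ghat.inner)) ↔
      ∃ Gtilde : Bundle.ContMDiffRiemannianMetric I ∞ (EuclideanSpace ℝ (Fin (n - 1)))
          (fun x : N => TangentSpace I x),
        ∀ r > 0, ∀ x, G r x = r ^ 2 • Gtilde.inner x) ∧
    (∀ r₀ ∈ Icc (0 : EReal) ⊤,
      RadialMass.IsAsymptoticAt I (fun r => r) Ghat.inner G r₀ →
      (Minf - M₀ = ∫ p : ℝ × N, p.1 ^ 2 * RadialMass.radialRicci I G p.1 p.2
          ∂((volume.restrict (Ioi 0)).prod (RadialMass.volumeMeasure I Ghat.inner)) ↔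
        ∀ r > 0, ∀ x, G r x = r ^ 2 • Ghat.inner x)) := by
  have hmf := RadialMass.isMetricFamily_const Ghat
  have hGs := hG.isSmoothFamily
  obtain ⟨hle, hiff⟩ := hmf.isSmoothFamily.mass_inequality hGs hM₀ hMinf hR
  -- Setting r = 1 in G(r) = r² G̃ shows that the only possible witness is G̃ = G(1).
  refine ⟨hle, hiff.trans ⟨fun h => ⟨hG.metric one_pos, h⟩, fun ⟨Gt, h⟩ r hr x => ?_⟩,
    fun r₀ hr₀ hasym => hiff.trans ⟨fun h r hr x => ?_, fun h r hr x => ?_⟩⟩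
  · rw [h r hr, h 1 one_pos, one_pow, one_smul]
  · rw [h r hr, RadialMass.eq_of_isAsymptoticAt hmf.isSmoothFamily hGs hr₀ hasym h]
  · rw [h r hr, h 1 one_pos, one_pow, one_smul]
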